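/- Let $q,s\in\mathbb{C}$ with $|q|<1$, $|s|<1$, and write $(a;q)_k=\prod_{i=1}^{k}(1-aq^{i-1})$, $(a;q)_\infty=\prod_{i\ge1}(1-aq^{i-1})$. For $i,j,k,\ell\in\mathbb{Z}_{\ge0}$ define the vertex weight (bottom, left, top, right edge states $i,j,k,\ell$) $$W_x(i,j;k,\ell)=\mathbf 1_{i+j=k+\ell}\,\mathbf 1_{i\ge\ell}\;x^\ell\,\frac{(-s/x;q)_\ell\,(-sx;q)_{i-\ell}\,(q;q)_k}{(q;q)_\ell\,(q;q)_{i-\ell}\,(s^2;q)_k},$$ where $x^\ell(-s/x;q)_\ell$ denotes the polynomial $\prod_{i=1}^{\ell}(x+sq^{i-1})$, and $$W_x(\infty,j;\infty,\ell)=\lim_{i\to\infty}W_x(i,j;i+j-\ell,\ell)=x^\ell\,\frac{(-s/x;q)_\ell\,(-sx;q)_\infty}{(q;q)_\ell\,(s^2;q)_\infty}.$$ For a partition $\lambda=(\lambda_1\ge\lambda_2\ge\cdots)$ with conjugate $\lambda'$, let $m_i(\lambda')=\lambda_i-\lambda_{i+1}$ be the number of parts of $\lambda'$ equal to $i$. Consider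 the square lattice with $n$ rows (numbered from bottom to top, row $r$ having parameter $x_r$) and columns $0,1,2,\dots$. All vertical edges of column $0$ are in state $\infty$; all other edges carry states in $\mathbb{Z}_{\ge0}$. The left boundary edges and the far right horizontal edges are in state $0$; in each column $i\ge1$ the bottom boundary edge is in state $0$ and the top boundary edge is in state $m_i(\lambda')$. Let $Z_\lambda(x_1,\dots,x_n)$ be the sum, over all assignments of states to the interior edges, of the product of all vertex weights. The spin $q$-Whittaker polynomial and its dual are $$\mathbb{F}_\lambda(x_1,\dots,x_n)=Z_\lambda(x_1,\dots,x_n)\prod_{i=1}^n\frac{(s^2;q)_\infty}{(-sx_i;q)_\infty},\qquad \mathbb{F}^*_\lambda(x_1,\dots,x_n)=\mathbb{F}_\lambda(x_1,\dots,x_n)\prod_{i\ge1}\frac{(s^2;q)_{\lambda_i-\lambda_{i+1}}}{(q;q)_{\lambda_i-\lambda_{i+1}}}.$$ **Corollary (Cauchy identity).** Let $m,n$ be positive integers and let $x_1,\dots,x_m,y_1,\dots,y_n\in\mathbb{C}$ all lie in the open unit disc. Then the following sum over all partitions $\lambda$ converges unconditionally, and $$\sum_\lambda \mathbb{F}_\lambda(x_1,\dots,x_m)\,\mathbb{F}^*_\lambda(y_1,\dots,y_n)=\prod_{i=1}^m\prod_{j=1}^n\frac{(-sx_i;q)_\infty\,(-sy_j;q)_\infty}{(s^2;q)_\infty\,(x_iy_j;q)_\infty}.$$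 -/

import Mathlib

namespace SpinQWhittaker

open Filter Topology

/-! ### q-Pochhammer symbols -/

/-- The finite q-Pochhammer symbol `(a;q)_m = ∏_{1 ≤ i ≤ m} (1 - a q^{i-1})`, `m ≥ 0`. -/
noncomputable def qPoch (a q : ℂ) (m : ℕ) : ℂ := ∏ i ∈ Finset.range m, (1 - a * q ^ i)

/-- The infinite q-Pochhammer symbol `(a;q)_∞ = ∏_{i ≥ 1} (1 - a q^{i-1})`
(used for `|q| < 1` only, where the product converges). -/
noncomputable def qPochInf (a q : ℂ) : ℂ := ∏' i : ℕ, (1 - a * q ^ i)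

/-- The polynomial `x^ℓ (-s/x;q)_ℓ = ∏_{1 ≤ i ≤ ℓ} (x + s q^{i-1})` in `x`;
see `numer_eq` for `x ≠ 0`. At `x = 0` it has its value as a polynomial. -/
noncomputable def numer (q s x : ℂ) (l : ℕ) : ℂ := ∏ i ∈ Finset.range l, (x + s * q ^ i)

theorem numer_eq (q s x : ℂ) (hx : x ≠ 0) (l : ℕ) :
    numer q s x l = x ^ l * qPoch (-s / x) q l := by
  unfold numer qPoch
  rw [← Finset.card_range l, ← Finset.prod_const, Finset.card_range, ← Finset.prod_mul_distrib]
  refine Finset.prod_congr rfl fun i _ => ?_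
  field_simp
  ring

theorem tendsto_qPoch (a q : ℂ) (hq : ‖q‖ < 1) :
    Tendsto (qPoch a q) atTop (𝓝 (qPochInf a q)) := by
  have h : Multipliable fun i : ℕ => 1 + -(a * q ^ i) := by
    apply multipliable_one_add_of_summable
    simp only [norm_neg, norm_mul, norm_pow]
    exact (summable_geometric_of_lt_one (norm_nonneg q) hq).mul_left _
  simp only [← sub_eq_add_neg] at h
  exact h.hasProd.tendsto_prod_nat

theorem one_sub_mul_pow_ne_zero (a q : ℂ) (ha : ‖a‖ < 1) (hq : ‖q‖ < 1) (i : ℕ) :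
    1 - a * q ^ i ≠ 0 := by
  intro h
  have h1 : a * q ^ i = 1 := (sub_eq_zero.mp h).symm
  have h2 : ‖a‖ * ‖q‖ ^ i = 1 := by rw [← norm_pow, ← norm_mul, h1, norm_one]
  have h3 : ‖q‖ ^ i ≤ 1 := pow_le_one₀ (norm_nonneg q) hq.le
  nlinarith [norm_nonneg a, norm_nonneg q]

theorem qPoch_ne_zero (a q : ℂ) (ha : ‖a‖ < 1) (hq : ‖q‖ < 1) (m : ℕ) : qPoch a q m ≠ 0 :=
  Finset.prod_ne_zero_iff.mpr fun i _ => one_sub_mul_pow_ne_zero a q ha hq i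

theorem qPochInf_ne_zero (a q : ℂ) (ha : ‖a‖ < 1) (hq : ‖q‖ < 1) : qPochInf a q ≠ 0 := by
  have h := tprod_one_add_ne_zero_of_summable (f := fun i : ℕ => -(a * q ^ i))
    (fun i => by
      rw [← sub_eq_add_neg]
      exact one_sub_mul_pow_ne_zero a q ha hq i)
    (by
      simp only [norm_neg, norm_mul, norm_pow]
      exact (summable_geometric_of_lt_one (norm_nonneg q) hq).mul_left _)
  simpa only [qPochInf, sub_eq_add_neg] using h

/-! ### Vertex weights -/

/-- The vertex weight
`W_x(i,j;k,ℓ) = 1_{i+j=k+ℓ} 1_{i≥ℓ} x^ℓ (-s/x;q)_ℓ (-sx;q)_{i-ℓ} (q;q)_k /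
  ((q;q)_ℓ (q;q)_{i-ℓ} (s²;q)_k)`,
where `i`, `j`, `k`, `ℓ` are the states of the bottom, left, top and right edge. -/
noncomputable def W (q s x : ℂ) (i j k l : ℕ) : ℂ :=
  if i + j = k + l ∧ l ≤ i then
    numer q s x l * qPoch (-s * x) q (i - l) * qPoch q q k /
      (qPoch q q l * qPoch q q (i - l) * qPoch (s ^ 2) q k)
  else 0

/-- The weight of a vertex in column `0`, whose bottom and top edges are in state `∞` and whose
right edge is in state `ℓ`: `x^ℓ (-s/x;q)_ℓ (-sx;q)_∞ / ((q;q)_ℓ (s²;q)_∞)`, for every state of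
the left edge. It is the limit of `W_x(i,j;i+j-ℓ,ℓ)` as `i → ∞`, see `tendsto_W`. -/
noncomputable def WInf (q s x : ℂ) (l : ℕ) : ℂ :=
  numer q s x l * qPochInf (-s * x) q / (qPoch q q l * qPochInf (s ^ 2) q)

theorem tendsto_W (q s x : ℂ) (hq : ‖q‖ < 1) (hs : ‖s‖ < 1) (j l : ℕ) :
    Tendsto (fun i => W q s x i j (i + j - l) l) atTop (𝓝 (WInf q s x l)) := by
  have hs2 : ‖s ^ 2‖ < 1 := by
    rw [norm_pow]; exact pow_lt_one₀ (norm_nonneg s) hs two_ne_zero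
  have t1 : Tendsto (fun i : ℕ => i - l) atTop atTop := tendsto_sub_atTop_nat l
  have t2 : Tendsto (fun i : ℕ => i + j - l) atTop atTop :=
    (tendsto_sub_atTop_nat l).comp (tendsto_add_atTop_nat j)
  have hqq := qPochInf_ne_zero q q hq hq
  have hss := qPochInf_ne_zero (s ^ 2) q hs2 hq
  have hl := qPoch_ne_zero q q hq hq l
  have key : Tendsto (fun i => numer q s x l * qPoch (-s * x) q (i - l) * qPoch q q (i + j - l) /
      (qPoch q q l * qPoch q q (i - l) * qPoch (s ^ 2) q (i + j - l))) atTop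
      (𝓝 (numer q s x l * qPochInf (-s * x) q * qPochInf q q /
        (qPoch q q l * qPochInf q q * qPochInf (s ^ 2) q))) := by
    refine Tendsto.div ?_ ?_ (mul_ne_zero (mul_ne_zero hl hqq) hss)
    · exact (((tendsto_qPoch _ _ hq).comp t1).const_mul _).mul ((tendsto_qPoch _ _ hq).comp t2)
    · exact (((tendsto_qPoch _ _ hq).comp t1).const_mul _).mul ((tendsto_qPoch _ _ hq).comp t2)
  have e : numer q s x l * qPochInf (-s * x) q * qPochInf q q /
        (qPoch q q l * qPochInf q q * qPochInf (s ^ 2) q) = WInf q s x l := by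
    unfold WInf
    field_simp
  rw [← e]
  refine key.congr' ?_
  filter_upwards [eventually_ge_atTop l] with i hi
  rw [W, if_pos ⟨by omega, hi⟩]

/-! ### Partition states

A partition (with positive parts) `λ` is a `YoungDiagram`, with parts
`λ_i = λ.rowLen (i - 1)`, `i ≥ 1`, and conjugate `λ.transpose`. Columns `1, 2, 3, …` of the
lattice are indexed by `c = 0, 1, 2, …`. -/

/-- The state of the columns `1, 2, …` attached to `λ`: the entry at `c` is
`m_{c+1}(λ')`, the number of parts of the conjugate partition `λ'` equal to `c + 1`. -/
noncomputable def state (lam : YoungDiagram) : ℕ →₀ ℕ :=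
  Finsupp.ofSupportFinite (fun c => lam.transpose.rowLens.count (c + 1)) (by
    refine Set.Finite.subset
      ((lam.transpose.rowLens.toFinset.finite_toSet).preimage (f := Nat.succ)
        (Nat.succ_injective.injOn)) ?_
    intro c hc
    have : 0 < lam.transpose.rowLens.count (c + 1) := Nat.pos_of_ne_zero hc
    simpa using List.count_pos_iff.mp this)

/-- `m_{c+1}(λ') = λ_{c+1} - λ_{c+2}`. -/
theorem state_apply (lam : YoungDiagram) (c : ℕ) :
    state lam c = lam.rowLen c - lam.rowLen (c + 1) := by
  have h1 : state lam c = lam.transpose.rowLens.count (c + 1) := rfl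
  have h2 : lam.transpose.rowLens = (List.range (lam.rowLen 0)).map lam.colLen := by
    simp [YoungDiagram.rowLens, YoungDiagram.colLen_transpose]
  rw [h1, h2, List.count, List.countP_map, List.countP_eq_length_filter]
  have h3 : ((List.range (lam.rowLen 0)).filter ((fun x => x == c + 1) ∘ lam.colLen)).toFinset =
      Finset.Ico (lam.rowLen (c + 1)) (lam.rowLen c) := by
    ext j
    have e1 := YoungDiagram.mem_iff_lt_rowLen (μ := lam) (i := c) (j := j)
    have e2 := YoungDiagram.mem_iff_lt_rowLen (μ := lam) (i := c + 1) (j := j)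
    rw [YoungDiagram.mem_iff_lt_colLen] at e1 e2
    have e3 := lam.rowLen_anti 0 c (Nat.zero_le c)
    simp only [List.mem_toFinset, List.mem_filter, List.mem_range, Function.comp, beq_iff_eq,
      Finset.mem_Ico]
    omega
  rw [← List.toFinset_card_of_nodup (List.nodup_range.filter _), h3, Nat.card_Ico]

/-! ### Lattice partition functions -/

/-- An assignment of states to the edges of the lattice with rows `0, …, n - 1` (from bottom to
top) and columns `0, 1, 2, …`, where all vertical edges of column `0` are in state `∞` and all but
finitely many of the other edges are in state `0`.
* `vert r c` is the vertical edge of column `c + 1` below row `r` (for `r = n`: above the top row);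
* `hor r c` is the horizontal edge of row `r` between columns `c` and `c + 1`. -/
structure Config (n : ℕ) where
  vert : Fin (n + 1) → (ℕ →₀ ℕ)
  hor : Fin n → (ℕ →₀ ℕ)

/-- The weight of a configuration: the product of the weights of all vertices, where the vertices
in row `r` have parameter `x r`. All but finitely many factors are `1`, see
`finite_mulSupport`. -/
noncomputable def Config.weight (q s : ℂ) {n : ℕ} (x : Fin n → ℂ) (C : Config n) : ℂ :=
  ∏ r : Fin n, (WInf q s (x r) (C.hor r 0) *
    ∏ᶠ c : ℕ, W q s (x r) (C.vert r.castSucc c) (C.hor r c) (C.vert r.succ c) (C.hor r (c + 1)))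

/-- The partition function of the lattice with bottom boundary `μ` and top boundary `λ`:
the sum of the weights of all configurations with this boundary. Only finitely many of them have
non-zero weight, see `finite_support`. -/
noncomputable def partitionFunction (q s : ℂ) (lam mu : YoungDiagram) {n : ℕ} (x : Fin n → ℂ) :
    ℂ :=
  ∑ᶠ (C : Config n) (_ : C.vert 0 = state mu ∧ C.vert (Fin.last n) = state lam), C.weight q s x

/-- The skew spin q-Whittaker polynomial `𝔽_{λ/μ}(x_1, …, x_n)`: the partition function divided by
`∏_i (-s x_i;q)_∞ / (s²;q)_∞`. -/
noncomputable def skewF (q s : ℂ) (lam mu : YoungDiagram) {n : ℕ} (x : Fin n → ℂ) : ℂ :=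
  partitionFunction q s lam mu x / ∏ i : Fin n, (qPochInf (-s * x i) q / qPochInf (s ^ 2) q)

/-- The spin q-Whittaker polynomial `𝔽_λ = 𝔽_{λ/∅}`. -/
noncomputable def F (q s : ℂ) (lam : YoungDiagram) {n : ℕ} (x : Fin n → ℂ) : ℂ :=
  skewF q s lam ⊥ x

/-- `c_λ = ∏_{i ≥ 1} (s²;q)_{m_i(λ')} / (q;q)_{m_i(λ')}`; all but finitely many factors are `1`. -/
noncomputable def dualCoeff (q s : ℂ) (lam : YoungDiagram) : ℂ :=
  ∏ᶠ c : ℕ, (qPoch (s ^ 2) q (state lam c) / qPoch q q (state lam c))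

/-- The dual skew spin q-Whittaker polynomial `𝔽*_{λ/μ} = (c_λ / c_μ) 𝔽_{λ/μ}`. -/
noncomputable def skewFDual (q s : ℂ) (lam mu : YoungDiagram) {n : ℕ} (x : Fin n → ℂ) : ℂ :=
  dualCoeff q s lam / dualCoeff q s mu * skewF q s lam mu x

/-- The dual spin q-Whittaker polynomial `𝔽*_λ = 𝔽*_{λ/∅}`. -/
noncomputable def FDual (q s : ℂ) (lam : YoungDiagram) {n : ℕ} (x : Fin n → ℂ) : ℂ :=
  skewFDual q s lam ⊥ x

/-! ### The products and sums in these definitions are finite -/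

theorem finsupp_bound (f : ℕ →₀ ℕ) : ∃ M, ∀ c, M ≤ c → f c = 0 := by
  refine ⟨f.support.sup id + 1, fun c hc => ?_⟩
  by_contra h
  have := Finset.le_sup (f := id) (Finsupp.mem_support_iff.mpr h)
  simp only [id] at this
  omega

theorem finite_mulSupport (q s x : ℂ) (a b h : ℕ →₀ ℕ) :
    (Function.mulSupport fun c : ℕ => W q s x (a c) (h c) (b c) (h (c + 1))).Finite := by
  obtain ⟨M1, h1⟩ := finsupp_bound a
  obtain ⟨M2, h2⟩ := finsupp_bound b
  obtain ⟨M3, h3⟩ := finsupp_bound h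
  refine (Set.finite_lt_nat (M1 + M2 + M3)).subset fun c hc => ?_
  by_contra hlt
  replace hlt : M1 + M2 + M3 ≤ c := not_lt.mp hlt
  apply hc
  simp [h1 c (by omega), h2 c (by omega), h3 c (by omega), h3 (c + 1) (by omega), W, numer, qPoch]

theorem finite_support (q s : ℂ) (lam mu : YoungDiagram) {n : ℕ} (x : Fin n → ℂ) :
    {C : Config n | (C.vert 0 = state mu ∧ C.vert (Fin.last n) = state lam) ∧
      C.weight q s x ≠ 0}.Finite := by
  obtain ⟨M, hM⟩ := finsupp_bound (state lam)
  set S := ∑ c ∈ Finset.range M, state lam c with hS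
  let g : ℕ →₀ ℕ := Finsupp.onFinset (Finset.range M) (fun c => if c < M then S else 0)
    (fun c hc => by
      by_contra h
      exact hc (if_neg (by simpa using h)))
  have hfin : (Set.Iic g).Finite := Set.finite_Iic g
  have hg : ∀ f : ℕ →₀ ℕ, (∀ c, M ≤ c → f c = 0) → (∀ c, f c ≤ S) → f ∈ Set.Iic g := by
    intro f h1 h2 c
    change f c ≤ if c < M then S else 0
    split_ifs with h
    · exact h2 c
    · exact (h1 c (by omega)).le
  have hinj : Function.Injective (fun C : Config n => (C.vert, C.hor)) := by
    rintro ⟨v, h⟩ ⟨v', h'⟩ e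
    simpa using e
  refine Set.Finite.of_finite_image (f := fun C : Config n => (C.vert, C.hor))
    (Set.Finite.subset ((Set.Finite.pi' (fun _ => hfin)).prod (Set.Finite.pi' (fun _ => hfin))) ?_)
    hinj.injOn
  rintro _ ⟨C, ⟨⟨-, hC2⟩, hw⟩, rfl⟩
  have hv : ∀ r c, (C.vert (Fin.castSucc r) c + C.hor r c = C.vert r.succ c + C.hor r (c + 1)) ∧
      C.hor r (c + 1) ≤ C.vert r.castSucc c := by
    intro r c
    by_contra hcon
    have hr := right_ne_zero_of_mul (Finset.prod_ne_zero_iff.mp hw r (Finset.mem_univ r))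
    have hz : W q s (x r) (C.vert r.castSucc c) (C.hor r c) (C.vert r.succ c)
        (C.hor r (c + 1)) = 0 := by
      rw [W, if_neg hcon]
    have hf := finite_mulSupport q s (x r) (C.vert r.castSucc) (C.vert r.succ) (C.hor r)
    rw [finprod_eq_prod _ hf] at hr
    refine Finset.prod_ne_zero_iff.mp hr c ?_ hz
    simp [Function.mem_mulSupport, hz]
  -- one row: bounds on the top edges give bounds on the other edges
  have step : ∀ r : Fin n, ((∀ c, M ≤ c → C.vert r.succ c = 0) ∧
      ∑ c ∈ Finset.range M, C.vert r.succ c ≤ S) →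
      ((∀ c, M ≤ c → C.vert r.castSucc c = 0) ∧
        ∑ c ∈ Finset.range M, C.vert r.castSucc c ≤ S) ∧
      (∀ c, M ≤ c → C.hor r c = 0) ∧ C.hor r 0 ≤ S := by
    rintro r ⟨ht, hs⟩
    obtain ⟨K, hK⟩ := finsupp_bound (C.hor r)
    have hh : ∀ d c, M ≤ c → C.hor r c ≤ C.hor r (c + d) := by
      intro d
      induction d with
      | zero => intro c _; exact le_rfl
      | succ d ih =>
        intro c hc
        have h1 := ih c hc
        have h2 := (hv r (c + d)).1
        have h3 := ht (c + d) (by omega)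
        rw [← add_assoc]
        omega
    have hh0 : ∀ c, M ≤ c → C.hor r c = 0 := by
      intro c hc
      have h1 := hh K c hc
      have h2 := hK (c + K) (by omega)
      omega
    have hv0 : ∀ c, M ≤ c → C.vert r.castSucc c = 0 := by
      intro c hc
      have h1 := (hv r c).1
      have h2 := ht c hc
      have h3 := hh0 (c + 1) (by omega)
      omega
    have hsum : ∀ N, ∑ c ∈ Finset.range N, C.vert r.castSucc c + C.hor r 0 =
        ∑ c ∈ Finset.range N, C.vert r.succ c + C.hor r N := by
      intro N
      induction N with
      | zero => simp
      | succ N ih =>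
        rw [Finset.sum_range_succ, Finset.sum_range_succ]
        have := (hv r N).1
        omega
    have h1 := hsum M
    have h2 := hh0 M le_rfl
    exact ⟨⟨hv0, by omega⟩, hh0, by omega⟩
  have all : ∀ r : Fin (n + 1), (∀ c, M ≤ c → C.vert r c = 0) ∧
      ∑ c ∈ Finset.range M, C.vert r c ≤ S := by
    intro r
    induction r using Fin.reverseInduction with
    | last => rw [hC2]; exact ⟨hM, le_rfl⟩
    | cast r ih => exact (step r ih).1
  have hle : ∀ r c, C.vert r c ≤ S := by
    intro r c
    by_cases h : c < M
    · exact (Finset.single_le_sum (f := fun c => C.vert r c) (fun _ _ => Nat.zero_le _)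
        (Finset.mem_range.mpr h)).trans (all r).2
    · rw [(all r).1 c (by omega)]; exact Nat.zero_le _
  refine ⟨fun r => hg _ (all r).1 (hle r), fun r => hg _ (step r (all r.succ)).2.1 ?_⟩
  intro c
  cases c with
  | zero => exact (step r (all r.succ)).2.2
  | succ c => exact (hv r c).2.trans (hle _ _)

end SpinQWhittaker

/-!
Write `𝔽_{λ/μ}(x)` for the one-variable skew function (`rowU`) and `𝔽*_{λ/μ}(y)` for its dual
(`rowV`); both are explicit products over the parts of `λ` and `μ`, and summing over the states of
one row of the lattice at a time gives the branching rules `hasSum_F_succ` and `hasSum_FDual_succ`.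
By branching, the Cauchy identity follows from its case of one variable `x`,
`E(x) := ∑_λ 𝔽*_λ(y_1, …, y_n) 𝔽_{λ/μ}(x) = ∏_j (-sx)_∞ (-s y_j)_∞ / ((s²)_∞ (x y_j)_∞) 𝔽*_μ(y)`,
which is `rowSum_eq`.

The proof of the latter goes through a `q`-difference equation in `x`. Let `T_x` be the row
operator of the higher spin six-vertex model, whose horizontal edges carry states `0` and `1` only
(`rowT`), with its spectral parameter tied to `x`. Two facts about `T_x` are used.
* Fusion (`hasSum_rowT_mul_rowU`): `∑_ν T_x(λ, ν) 𝔽_{ν/μ}(x) = 𝔽_{λ/μ}(q x)`.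
* Exchange (`exchange`): `∑_λ 𝔽*_{λ/ν}(y) T_x(λ, μ) = (1 - xy)/(1 + sx) ∑_κ T_x(ν, κ) 𝔽*_{μ/κ}(y)`.
  Iterated over `y_1, …, y_n`, it makes `λ ↦ 𝔽*_λ(y)` an eigenfunction of `T_x`
  (`hasSum_FDual_mul_rowT`).

In both facts a sum over partitions is a sum over sequences of `0`s and `1`s, that is, a product of
`2 × 2` matrices, one for each column; it is evaluated by moving a vector (`fusion_column`) or an
intertwining matrix (`exchange_column`) through the columns from left to right.

Together they give `E(q x) = ∏_j (1 - x y_j)/(1 + s x) · E(x)` (`rowSum_mul`). Iterating, with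
`q^k x → 0`, one gets `E(0) = ∏_j (x y_j)_∞ / (-s x)_∞ · E(x)` for all `x` in the unit disc. At
`x = -s` the function `𝔽_{λ/μ}(x)` is `1` for `λ = μ` and `0` otherwise, so that `E(-s) = 𝔽*_μ(y)`;
comparing `x` with `-s` gives `E(x)`.

All interchanges of sums rest on the bounds `|𝔽_λ(x)| ≤ C r^|λ|` with some `r < 1`, on partitions
with at most as many parts as there are variables (`decays_F`).
-/

namespace SpinQWhittaker

open Filter Topology


/-! ### Local weights on the integers -/

/-- The extension of a function on `ℕ` to `ℤ` by zero. -/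
noncomputable def zext (f : ℕ → ℂ) (k : ℤ) : ℂ := if 0 ≤ k then f k.toNat else 0

@[simp] theorem zext_natCast (f : ℕ → ℂ) (k : ℕ) : zext f (k : ℤ) = f k := by simp [zext]

theorem zext_of_neg (f : ℕ → ℂ) {k : ℤ} (hk : k < 0) : zext f k = 0 := if_neg (by omega)

theorem nonneg_of_zext_ne_zero {f : ℕ → ℂ} {k : ℤ} (h : zext f k ≠ 0) : 0 ≤ k := by
  by_contra hk
  exact h (zext_of_neg f (by omega))

/-- `x^ℓ (-s/x;q)_ℓ / (q;q)_ℓ`, the weight of a jump by `ℓ`; zero for `ℓ < 0`. -/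
noncomputable def jump (q s x : ℂ) : ℤ → ℂ := zext fun l => numer q s x l / qPoch q q l

/-- `(-sx;q)_k / (q;q)_k`; zero for `k < 0`. -/
noncomputable def stay (q s x : ℂ) : ℤ → ℂ := zext fun k => qPoch (-s * x) q k / qPoch q q k

/-- `(q;q)_k / (s²;q)_k`; zero for `k < 0`. -/
noncomputable def gap (q s : ℂ) : ℤ → ℂ := zext fun k => qPoch q q k / qPoch (s ^ 2) q k

/-- The weight of a vertex whose horizontal edges are in states `e`, `e'` from `{0, 1}` and whose
bottom edge is in state `m`. It is normalized so that the empty vertex has weight `1`. -/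
noncomputable def halfW (q s x : ℂ) (m e e' : ℤ) : ℂ :=
  (if e = 0 ∧ e' = 0 then 1 + s * x * q ^ m.toNat
   else if e = 0 ∧ e' = 1 then -x * (1 - s ^ 2 * q ^ (m - 1).toNat)
   else if e = 1 ∧ e' = 0 then 1 - q ^ (m.toNat + 1)
   else if e = 1 ∧ e' = 1 then -(x + s * q ^ m.toNat)
   else 0) / (1 + s * x)

/-- The factor of column `0` in a row of `halfW` vertices: `1` and `-x` for the states `0` and `1`
of its right edge. -/
noncomputable def halfLead (x : ℂ) (e : ℤ) : ℂ := if e = 0 then 1 else if e = 1 then -x else 0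

theorem qPoch_succ (a q : ℂ) (k : ℕ) : qPoch a q (k + 1) = qPoch a q k * (1 - a * q ^ k) :=
  Finset.prod_range_succ _ _

theorem numer_succ (q s x : ℂ) (k : ℕ) : numer q s x (k + 1) = numer q s x k * (x + s * q ^ k) :=
  Finset.prod_range_succ _ _

theorem numer_mul_succ (q s x : ℂ) (k : ℕ) :
    numer q s (q * x) (k + 1) = (q * x + s) * q ^ k * numer q s x k := by
  unfold numer
  rw [Finset.prod_range_succ', mul_comm]
  have : ∀ i ∈ Finset.range k, q * x + s * q ^ (i + 1) = q * (x + s * q ^ i) := fun i _ => by ring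
  rw [Finset.prod_congr rfl this, Finset.prod_mul_distrib]
  simp
  ring

theorem qPoch_mul_shift (a q : ℂ) (k : ℕ) :
    qPoch (q * a) q k * (1 - a) = qPoch a q k * (1 - a * q ^ k) := by
  rw [← qPoch_succ]
  unfold qPoch
  rw [Finset.prod_range_succ']
  simp only [pow_succ, pow_zero, mul_one]
  congr 1
  exact Finset.prod_congr rfl fun i _ => by ring

section
variable {q s : ℂ}

theorem one_sub_pow_succ_ne_zero (hq : ‖q‖ < 1) (k : ℕ) : 1 - q ^ (k + 1) ≠ 0 := by
  have := one_sub_mul_pow_ne_zero q q hq hq k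
  rwa [← pow_succ'] at this

theorem norm_sq_lt_one (hs : ‖s‖ < 1) : ‖s ^ 2‖ < 1 := by
  rw [norm_pow]; exact pow_lt_one₀ (norm_nonneg s) hs two_ne_zero

theorem norm_neg_mul_lt_one (hs : ‖s‖ < 1) {x : ℂ} (hx : ‖x‖ < 1) : ‖-s * x‖ < 1 := by
  rw [norm_mul, norm_neg]
  nlinarith [norm_nonneg s, norm_nonneg x]

theorem one_add_mul_ne_zero (hs : ‖s‖ < 1) {x : ℂ} (hx : ‖x‖ < 1) : 1 + s * x ≠ 0 := by
  have := one_sub_mul_pow_ne_zero (-s * x) 0 (norm_neg_mul_lt_one hs hx) (by simp) 0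
  intro h
  apply this
  linear_combination h

theorem jump_succ (hq : ‖q‖ < 1) (x : ℂ) (k : ℕ) :
    jump q s x ((k : ℤ) + 1) * (1 - q ^ (k + 1)) = jump q s x k * (x + s * q ^ k) := by
  have h1 := qPoch_ne_zero q q hq hq k
  have h2 := one_sub_pow_succ_ne_zero hq k
  have h3 : ((k : ℤ) + 1) = ((k + 1 : ℕ) : ℤ) := by push_cast; ring
  rw [h3, jump, zext_natCast, zext_natCast, numer_succ, qPoch_succ, ← pow_succ']
  field_simp

theorem jump_mul_succ (hq : ‖q‖ < 1) (x : ℂ) (k : ℕ) :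
    jump q s (q * x) ((k : ℤ) + 1) * (1 - q ^ (k + 1)) =
      jump q s x k * ((q * x + s) * q ^ k) := by
  have h1 := qPoch_ne_zero q q hq hq k
  have h2 := one_sub_pow_succ_ne_zero hq k
  have h3 : ((k : ℤ) + 1) = ((k + 1 : ℕ) : ℤ) := by push_cast; ring
  rw [h3, jump, jump, zext_natCast, zext_natCast, numer_mul_succ, qPoch_succ, ← pow_succ']
  field_simp

theorem stay_succ (hq : ‖q‖ < 1) (x : ℂ) (k : ℕ) :
    stay q s x ((k : ℤ) + 1) * (1 - q ^ (k + 1)) = stay q s x k * (1 + s * x * q ^ k) := by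
  have h1 := qPoch_ne_zero q q hq hq k
  have h2 := one_sub_pow_succ_ne_zero hq k
  have h3 : ((k : ℤ) + 1) = ((k + 1 : ℕ) : ℤ) := by push_cast; ring
  rw [h3, stay, zext_natCast, zext_natCast, qPoch_succ, qPoch_succ, ← pow_succ']
  field_simp
  ring

theorem stay_mul (hq : ‖q‖ < 1) (x : ℂ) (k : ℕ) :
    stay q s (q * x) k * (1 + s * x) = stay q s x k * (1 + s * x * q ^ k) := by
  have h1 := qPoch_ne_zero q q hq hq k
  rw [stay, stay, zext_natCast, zext_natCast]
  have := qPoch_mul_shift (-s * x) q k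
  rw [show q * (-s * x) = -s * (q * x) by ring] at this
  rw [div_mul_eq_mul_div, div_mul_eq_mul_div]
  congr 1
  linear_combination this

theorem gap_succ (hq : ‖q‖ < 1) (hs : ‖s‖ < 1) (k : ℕ) :
    gap q s ((k : ℤ) + 1) * (1 - s ^ 2 * q ^ k) = gap q s k * (1 - q ^ (k + 1)) := by
  have h1 := qPoch_ne_zero (s ^ 2) q (norm_sq_lt_one hs) hq k
  have h2 := one_sub_mul_pow_ne_zero (s ^ 2) q (norm_sq_lt_one hs) hq k
  have h3 : ((k : ℤ) + 1) = ((k + 1 : ℕ) : ℤ) := by push_cast; ring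
  rw [h3, gap, zext_natCast, zext_natCast, qPoch_succ, qPoch_succ, ← pow_succ']
  field_simp

@[simp] theorem jump_zero (x : ℂ) : jump q s x 0 = 1 := by simp [jump, zext, numer, qPoch]

@[simp] theorem stay_zero (x : ℂ) : stay q s x 0 = 1 := by simp [stay, zext, qPoch]

@[simp] theorem gap_zero : gap q s 0 = 1 := by simp [gap, zext, qPoch]

theorem jump_of_neg (x : ℂ) {k : ℤ} (hk : k < 0) : jump q s x k = 0 := zext_of_neg _ hk

theorem stay_of_neg (x : ℂ) {k : ℤ} (hk : k < 0) : stay q s x k = 0 := zext_of_neg _ hk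

theorem halfW_zero_zero (x : ℂ) (m : ℕ) :
    halfW q s x m 0 0 = (1 + s * x * q ^ m) / (1 + s * x) := by simp [halfW]

theorem halfW_zero_one (x : ℂ) (m : ℕ) :
    halfW q s x (m + 1) 0 1 = -x * (1 - s ^ 2 * q ^ m) / (1 + s * x) := by simp [halfW]

theorem halfW_one_zero (x : ℂ) (m : ℕ) :
    halfW q s x m 1 0 = (1 - q ^ (m + 1)) / (1 + s * x) := by simp [halfW]

theorem halfW_one_one (x : ℂ) (m : ℕ) :
    halfW q s x m 1 1 = -(x + s * q ^ m) / (1 + s * x) := by simp [halfW]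

@[simp] theorem halfLead_zero (x : ℂ) : halfLead x 0 = 1 := by simp [halfLead]

@[simp] theorem halfLead_one (x : ℂ) : halfLead x 1 = -x := by simp [halfLead]

/-! ### Local relations -/

/-- The fusion relation of one column: a row of `halfW` vertices on top of a row with parameter `x`
acts like a row with parameter `q x`, provided that the left edges are summed with the weights
`halfLead x e * jump q s x (h - e)`. Here `h` and `h'` are the total states of the left and the
right edges, and `k` is the state of the top edge. -/
theorem fusion_column (hq : ‖q‖ < 1) (hs : ‖s‖ < 1) {x : ℂ} (hx : ‖x‖ < 1) {h p k : ℤ} (h' : ℤ)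
    (hk : k = h + p) (hk0 : 0 ≤ k) {e' : ℤ} (he : e' = 0 ∨ e' = 1) :
    halfLead x 0 * jump q s x h *
        (halfW q s x (k + e') 0 e' *
          (jump q s x (h' - e') * stay q s x (p + e') * gap q s (k + e'))) +
      halfLead x 1 * jump q s x (h - 1) *
        (halfW q s x (k - 1 + e') 1 e' *
          (jump q s x (h' - e') * stay q s x (p + e') * gap q s (k - 1 + e'))) =
    jump q s (q * x) h * stay q s (q * x) p * gap q s k *
      (halfLead x e' * jump q s x (h' - e')) := by
  have hu := one_add_mul_ne_zero hs hx
  obtain hh | hh := lt_or_ge h 0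
  · rw [jump_of_neg _ hh, jump_of_neg _ hh, jump_of_neg _ (show h - 1 < 0 by omega)]; ring
  lift h to ℕ using hh
  -- up to common factors, each case is a polynomial identity among the first-order recurrences of
  -- `jump`, `stay` and `gap`, multiplied by `1 - q ^ h` if `h ≥ 1`
  rcases he with rfl | rfl
  · obtain hp | hp := lt_or_ge p 0
    · rw [stay_of_neg _ hp, stay_of_neg _ (show p + 0 < 0 by omega)]; ring
    lift p to ℕ using hp
    simp only [add_zero, sub_zero]
    have s1 := stay_mul (s := s) hq x p
    have j2 := fun j => jump_mul_succ (s := s) hq x j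
    generalize stay q s (q * x) p = Sq at s1 ⊢
    have jz : jump q s (q * x) (0 : ℕ) = 1 := by simp
    generalize jump q s (q * x) = Jq at j2 jz ⊢
    rcases h with _ | j
    · simp only [Nat.cast_zero, zero_add] at hk
      subst hk
      rw [halfW_zero_zero, jump_of_neg _ (show ((0 : ℕ) : ℤ) - 1 < 0 by simp), jz]
      simp only [halfLead_zero, Nat.cast_zero, jump_zero, mul_zero, zero_mul, add_zero, one_mul]
      rw [div_mul_eq_mul_div, div_eq_iff hu]
      linear_combination -gap q s p * jump q s x h' * s1
    · obtain rfl : k = ((j + p : ℕ) : ℤ) + 1 := by push_cast at hk ⊢; omega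
      have e1 : (((j + p : ℕ) : ℤ) + 1) = ((j + p + 1 : ℕ) : ℤ) := by push_cast; ring
      have e2 : (((j + p : ℕ) : ℤ) + 1 - 1) = ((j + p : ℕ) : ℤ) := by ring
      have e3 : (((j + 1 : ℕ) : ℤ) - 1) = (j : ℤ) := by push_cast; ring
      have e4 : ((j + 1 : ℕ) : ℤ) = (j : ℤ) + 1 := by push_cast; ring
      have g1 := gap_succ (s := s) hq hs (j + p)
      have j1 := jump_succ (s := s) hq x j
      replace j2 := j2 j
      rw [e2, e3, halfW_one_zero, e4]
      rw [e1] at g1 ⊢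
      rw [halfW_zero_zero]
      simp only [halfLead_zero, halfLead_one, div_mul_eq_mul_div, mul_div_assoc', ← add_div]
      rw [div_eq_iff hu]
      refine mul_left_cancel₀ (one_sub_pow_succ_ne_zero hq j) ?_
      linear_combination
        (1 + s * x * q ^ (j + p + 1)) * jump q s x h' * stay q s x p *
          gap q s ((j + p + 1 : ℕ) : ℤ) * j1
        + x * jump q s x j * (1 - q ^ (j + 1)) * jump q s x h' * stay q s x p * g1
        - (1 + s * x) * Sq * gap q s ((j + p + 1 : ℕ) : ℤ) * jump q s x h' * j2
        - jump q s x j * ((q * x + s) * q ^ j) * gap q s ((j + p + 1 : ℕ) : ℤ) *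
          jump q s x h' * s1
  · obtain hp | hp := lt_or_ge p (-1)
    · rw [stay_of_neg _ (show p < 0 by omega), stay_of_neg _ (show p + 1 < 0 by omega)]; ring
    lift k to ℕ using hk0
    have e0 : (k : ℤ) - 1 + 1 = k := by ring
    have g1 := gap_succ (s := s) hq hs k
    rw [e0, halfW_zero_one, halfW_one_one]
    simp only [halfLead_zero, halfLead_one, div_mul_eq_mul_div, mul_div_assoc', ← add_div]
    rw [div_eq_iff hu]
    obtain hp | hp := eq_or_lt_of_le hp
    · subst hp
      obtain rfl : h = k + 1 := by omega
      have j1 := jump_succ (s := s) hq x k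
      have e3 : (((k + 1 : ℕ) : ℤ) - 1) = (k : ℤ) := by push_cast; ring
      have e4 : ((k + 1 : ℕ) : ℤ) = (k : ℤ) + 1 := by push_cast; ring
      rw [e3, e4, stay_of_neg (q := q) (s := s) (q * x) (show (-1 : ℤ) < 0 by omega)]
      simp only [neg_add_cancel, stay_zero]
      linear_combination (-x * jump q s x (k + 1) * jump q s x (h' - 1)) * g1 -
        x * gap q s k * jump q s x (h' - 1) * j1
    · lift p to ℕ using (by omega)
      have s1 := stay_mul (s := s) hq x p
      have s2 := stay_succ (s := s) hq x p
      have j2 := fun j => jump_mul_succ (s := s) hq x j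
      generalize stay q s (q * x) p = Sq at s1 ⊢
      have jz : jump q s (q * x) (0 : ℕ) = 1 := by simp
      generalize jump q s (q * x) = Jq at j2 jz ⊢
      rcases h with _ | j
      · obtain rfl : k = p := by simp at hk; omega
        rw [jump_of_neg _ (show ((0 : ℕ) : ℤ) - 1 < 0 by simp), jz]
        simp only [Nat.cast_zero, jump_zero]
        linear_combination (-x * jump q s x (h' - 1) * stay q s x (k + 1)) * g1 -
          x * gap q s k * jump q s x (h' - 1) * s2 + x * gap q s k * jump q s x (h' - 1) * s1
      · obtain rfl : k = j + p + 1 := by push_cast at hk; omega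
        have e3 : (((j + 1 : ℕ) : ℤ) - 1) = (j : ℤ) := by push_cast; ring
        have e4 : ((j + 1 : ℕ) : ℤ) = (j : ℤ) + 1 := by push_cast; ring
        have j1 := jump_succ (s := s) hq x j
        replace j2 := j2 j
        rw [e3, e4]
        refine mul_left_cancel₀ (one_sub_pow_succ_ne_zero hq j) ?_
        have s3 : stay q s x (p + 1) * (1 - q ^ (p + 1)) = Sq * (1 + s * x) := s2.trans s1.symm
        linear_combination
          (-x * jump q s x (h' - 1) * stay q s x (p + 1) * (1 - q ^ (j + 1)) *
            jump q s x (j + 1)) * g1 -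
          (x * jump q s x (h' - 1) * stay q s x (p + 1) * gap q s ((j + p + 1 : ℕ) : ℤ) *
            (1 - q ^ (j + p + 1 + 1))) * j1 +
          (x * (1 + s * x) * Sq * gap q s ((j + p + 1 : ℕ) : ℤ) * jump q s x (h' - 1)) * j2 -
          (x * jump q s x j * ((q * x + s) * q ^ j) * gap q s ((j + p + 1 : ℕ) : ℤ) *
            jump q s x (h' - 1)) * s3

/-- The entry `(e, f)` of the matrix which intertwines the two sides of the exchange relation at an
edge where the parts of `μ` and `ν` differ by `d`. The row `e = 0` is meaningful only for `0 ≤ d`. -/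
noncomputable def crossW (q s x y : ℂ) (d e f : ℤ) : ℂ :=
  if e = 0 ∧ f = 0 then 1 + s * x * q ^ d.toNat
  else if e = 0 ∧ f = 1 then -x * (y + s * q ^ d.toNat)
  else if e = 1 ∧ f = 0 then 1 - q ^ (d + 1).toNat
  else q ^ (d + 1).toNat - x * y

theorem crossW_zero_zero (x y : ℂ) (d : ℕ) :
    crossW q s x y d 0 0 = 1 + s * x * q ^ d := by simp [crossW]

theorem crossW_zero_one (x y : ℂ) (d : ℕ) :
    crossW q s x y d 0 1 = -x * (y + s * q ^ d) := by simp [crossW]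

theorem crossW_one_zero (x y : ℂ) (d : ℤ) :
    crossW q s x y d 1 0 = 1 - q ^ (d + 1).toNat := by simp [crossW]

theorem crossW_one_one (x y : ℂ) (d : ℤ) :
    crossW q s x y d 1 1 = q ^ (d + 1).toNat - x * y := by simp [crossW]

theorem halfW_mul_gap_succ (hq : ‖q‖ < 1) (hs : ‖s‖ < 1) (x : ℂ) (n : ℕ) :
    halfW q s x (n + 1) 0 1 * gap q s (n + 1) =
      -x * (1 - q ^ (n + 1)) * gap q s n / (1 + s * x) := by
  rw [halfW_zero_one, div_mul_eq_mul_div]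
  congr 1
  linear_combination -x * gap_succ hq hs n

theorem halfW_mul_gap_pred (hq : ‖q‖ < 1) (hs : ‖s‖ < 1) (x : ℂ) (n : ℕ) :
    halfW q s x n 1 0 * gap q s n =
      (1 - s ^ 2 * q ^ n) * gap q s (n + 1) / (1 + s * x) := by
  rw [halfW_one_zero, div_mul_eq_mul_div]
  congr 1
  linear_combination -gap_succ hq hs n

/-- Two consecutive values of `jump` in terms of a common factor, free of denominators. -/
theorem exists_jump_eq (hq : ‖q‖ < 1) (y : ℂ) (d : ℕ) :
    ∃ z, jump q s y d = z * (1 - q ^ (d + 1)) ∧ jump q s y (d + 1) = z * (y + s * q ^ d) := by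
  have h := one_sub_pow_succ_ne_zero hq d
  refine ⟨jump q s y d / (1 - q ^ (d + 1)), by field_simp, ?_⟩
  rw [div_mul_eq_mul_div, eq_div_iff h, jump_succ hq]

theorem exists_stay_eq (hq : ‖q‖ < 1) (y : ℂ) (d : ℕ) :
    ∃ z, stay q s y d = z * (1 - q ^ (d + 1)) ∧ stay q s y (d + 1) = z * (1 + s * y * q ^ d) := by
  have h := one_sub_pow_succ_ne_zero hq d
  refine ⟨stay q s y d / (1 - q ^ (d + 1)), by field_simp, ?_⟩
  rw [div_mul_eq_mul_div, eq_div_iff h, stay_succ hq]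

/-- The exchange relation of one column: `crossW` moves from the right edges, with the column of the
left side of `exchange`, to the left edges, with the column of the right side. Here `d` and `d'` are
the differences `μ - ν` of the parts at the left and the right edges, and `m` and `n` are the states
of the vertical edges given by `μ` and `ν`. The condition on `d + e` excludes the left states for
which `jump` vanishes. -/
theorem exchange_column (hq : ‖q‖ < 1) (hs : ‖s‖ < 1) {x : ℂ} (y : ℂ) (hx : ‖x‖ < 1)
    {d d' p m n : ℤ} (hm : m = p + d) (hn : n = p + d') (hm0 : 0 ≤ m) (hn0 : 0 ≤ n) {e f : ℤ}
    (he : e = 0 ∨ e = 1) (hf : f = 0 ∨ f = 1) (hde : 0 ≤ d + e) :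
    halfW q s x m e 0 * (jump q s y d' * stay q s y p * gap q s n) * crossW q s x y d' 0 f +
      halfW q s x m e 1 * (jump q s y (d' + 1) * stay q s y (p - 1) * gap q s n) *
        crossW q s x y d' 1 f =
    crossW q s x y d e 0 * (halfW q s x (n + f) 0 f * (jump q s y (d' + f) * stay q s y p *
        gap q s (n + f))) +
      crossW q s x y d e 1 * (halfW q s x (n - 1 + f) 1 f * (jump q s y (d' + f) *
        stay q s y (p - 1) * gap q s (n - 1 + f))) := by
  have hu := one_add_mul_ne_zero hs hx
  obtain hp | hp := lt_or_ge p 0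
  · rw [stay_of_neg _ hp, stay_of_neg _ (show p - 1 < 0 by omega)]; ring
  lift p to ℕ using hp
  lift m to ℕ using hm0
  lift n to ℕ using hn0
  obtain hd' | hd' := lt_or_ge d' (-1)
  · rw [jump_of_neg _ (show d' < 0 by omega), jump_of_neg _ (show d' + 1 < 0 by omega),
      jump_of_neg _ (show d' + f < 0 by omega)]; ring
  have hA := halfW_mul_gap_succ hq hs x n
  rcases p with _ | j
  · -- here `m = d` and `n = d'`, and all terms with `stay (p - 1)` vanish
    obtain rfl : d = m := by omega
    obtain rfl : d' = n := by omega
    obtain ⟨z, z0, z1⟩ := exists_jump_eq (s := s) hq y n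
    rw [stay_of_neg _ (show ((0 : ℕ) : ℤ) - 1 < 0 by simp)]
    simp only [Nat.cast_zero, stay_zero, mul_zero, zero_mul, add_zero, mul_one]
    rcases he with rfl | rfl <;> rcases hf with rfl | rfl <;>
      simp only [add_zero, halfW_zero_zero, halfW_one_zero, z0, z1, crossW_zero_zero,
        crossW_zero_one, crossW_one_zero, Int.toNat_natCast_add_one]
    · ring
    · linear_combination (-z * (y + s * q ^ n) * (1 + s * x * q ^ m)) * hA
    · ring
    · linear_combination (-z * (y + s * q ^ n) * (1 - q ^ (m + 1))) * hA
  · obtain ⟨v, v0, v1⟩ := exists_stay_eq (s := s) hq y j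
    have e1 : ((j + 1 : ℕ) : ℤ) = (j : ℤ) + 1 := by push_cast; ring
    have e2 : (j : ℤ) + 1 - 1 = (j : ℤ) := by ring
    have e3 : (n : ℤ) - 1 + 1 = n := by ring
    rw [e1] at hm hn ⊢
    rw [e2, v0, v1]
    obtain rfl | hd' := eq_or_lt_of_le hd'
    · obtain rfl : n = j := by omega
      rw [jump_of_neg (q := q) (s := s) y (show (-1 : ℤ) < 0 by omega)]
      rcases hf with rfl | rfl
      · rw [jump_of_neg (q := q) (s := s) y (show (-1 + 0 : ℤ) < 0 by omega), crossW_one_zero]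
        simp
      · rw [e3, halfW_one_one]
        simp only [neg_add_cancel, jump_zero, crossW_one_one, Int.toNat_zero, pow_zero]
        rcases he with rfl | rfl
        · lift d to ℕ using (by omega)
          obtain rfl : m = n + d + 1 := by omega
          push_cast
          rw [show (n : ℤ) + d + 1 = (n + d : ℕ) + 1 by push_cast; ring, halfW_zero_one,
            crossW_zero_zero, crossW_zero_one]
          linear_combination
            (-(1 + s * x * q ^ d) * v * (1 + s * y * q ^ n)) * hA
        · obtain ⟨k, hk⟩ : ∃ k : ℕ, (k : ℤ) = d + 1 := ⟨(d + 1).toNat, by omega⟩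
          obtain rfl : m = n + k := by omega
          rw [halfW_one_one, crossW_one_zero, crossW_one_one, ← hk, Int.toNat_natCast]
          linear_combination (-(1 - q ^ k) * v * (1 + s * y * q ^ n)) * hA
    · lift d' to ℕ using (by omega)
      obtain ⟨z, z0, z1⟩ := exists_jump_eq (s := s) hq y d'
      obtain rfl : n = j + d' + 1 := by omega
      have hB := halfW_mul_gap_pred hq hs x (j + d')
      have e4 : ((j + d' + 1 : ℕ) : ℤ) - 1 = (j + d' : ℕ) := by push_cast; ring
      have e5 : ((j + d' + 1 : ℕ) : ℤ) = (j + d' : ℕ) + 1 := by push_cast; ring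
      rw [← e5] at hB
      rcases hf with rfl | rfl
      · simp only [add_zero, e4, crossW_zero_zero, crossW_one_zero, z0, z1, halfW_zero_zero,
          Int.toNat_natCast_add_one]
        rcases he with rfl | rfl
        · lift d to ℕ using (by omega)
          obtain rfl : m = j + d + 1 := by omega
          have e6 : ((j + d + 1 : ℕ) : ℤ) = (j + d : ℕ) + 1 := by push_cast; ring
          have w1 := halfW_zero_one (q := q) (s := s) x (j + d)
          rw [← e6] at w1
          rw [w1, halfW_zero_zero, crossW_zero_zero, crossW_zero_one]
          linear_combination
            (x * (y + s * q ^ d) * z * (1 - q ^ (d' + 1)) * v * (1 - q ^ (j + 1))) * hB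
        · obtain ⟨k, hk⟩ : ∃ k : ℕ, (k : ℤ) = d + 1 := ⟨(d + 1).toNat, by omega⟩
          obtain rfl : m = j + k := by omega
          rw [halfW_one_zero, halfW_one_one, crossW_one_zero, crossW_one_one, ← hk,
            Int.toNat_natCast]
          linear_combination
            (-(q ^ k - x * y) * z * (1 - q ^ (d' + 1)) * v * (1 - q ^ (j + 1))) * hB
      · simp only [e3, crossW_zero_one, crossW_one_one, z0, z1, halfW_one_one,
          Int.toNat_natCast_add_one]
        rcases he with rfl | rfl
        · lift d to ℕ using (by omega)
          obtain rfl : m = j + d + 1 := by omega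
          have e6 : ((j + d + 1 : ℕ) : ℤ) = (j + d : ℕ) + 1 := by push_cast; ring
          have w1 := halfW_zero_one (q := q) (s := s) x (j + d)
          rw [← e6] at w1
          rw [w1, halfW_zero_zero, crossW_zero_zero, crossW_zero_one]
          linear_combination
            (-(1 + s * x * q ^ d) * z * (y + s * q ^ d') * v * (1 + s * y * q ^ j)) * hA
        · obtain ⟨k, hk⟩ : ∃ k : ℕ, (k : ℤ) = d + 1 := ⟨(d + 1).toNat, by omega⟩
          obtain rfl : m = j + k := by omega
          rw [halfW_one_zero, halfW_one_one, crossW_one_zero, crossW_one_one, ← hk,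
            Int.toNat_natCast]
          linear_combination
            (-(1 - q ^ k) * z * (y + s * q ^ d') * v * (1 + s * y * q ^ j)) * hA
end

/-! ### Row weights of integer sequences -/

/-- The sequence `λ_1, λ_2, …` of the parts of a partition. -/
def parts (lam : YoungDiagram) (c : ℕ) : ℤ := lam.rowLen c

/-- The one-variable skew function `𝔽_{a/b}(x)` as a product over the parts of `a` and `b`. -/
noncomputable def rowU (q s x : ℂ) (a b : ℕ → ℤ) : ℂ :=
  jump q s x (a 0 - b 0) * ∏ᶠ c, (jump q s x (a (c + 1) - b (c + 1)) *
    stay q s x (b c - a (c + 1)) * gap q s (a c - a (c + 1)))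

/-- The one-variable dual skew function `𝔽*_{a/b}(x)` as a product over the parts of `a` and `b`. -/
noncomputable def rowV (q s x : ℂ) (a b : ℕ → ℤ) : ℂ :=
  jump q s x (a 0 - b 0) * ∏ᶠ c, (jump q s x (a (c + 1) - b (c + 1)) *
    stay q s x (b c - a (c + 1)) * gap q s (b c - b (c + 1)))

/-- The weight of a row of `halfW` vertices; it is supported on `a - b ∈ {0, 1}`. -/
noncomputable def rowT (q s x : ℂ) (a b : ℕ → ℤ) : ℂ :=
  halfLead x (a 0 - b 0) *
    ∏ᶠ c, halfW q s x (b c - b (c + 1)) (a c - b c) (a (c + 1) - b (c + 1))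

theorem finprod_eq_prod_range_of_eq_one {f : ℕ → ℂ} {n : ℕ} (h : ∀ c, n ≤ c → f c = 1) :
    ∏ᶠ c, f c = ∏ c ∈ Finset.range n, f c := by
  refine finprod_eq_prod_of_mulSupport_subset _ fun c hc => ?_
  by_contra hlt
  exact hc (h c (by simpa using hlt))

section
variable {q s x : ℂ} {a b : ℕ → ℤ} {n : ℕ}

theorem rowU_eq_prod (ha : ∀ c, n ≤ c → a c = 0) (hb : ∀ c, n ≤ c → b c = 0) :
    rowU q s x a b = jump q s x (a 0 - b 0) * ∏ c ∈ Finset.range n,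
      (jump q s x (a (c + 1) - b (c + 1)) * stay q s x (b c - a (c + 1)) *
        gap q s (a c - a (c + 1))) := by
  rw [rowU, finprod_eq_prod_range_of_eq_one (n := n) fun c hc => ?_]
  simp [ha c hc, hb c hc, ha (c + 1) (by omega), hb (c + 1) (by omega)]

theorem rowV_eq_prod (ha : ∀ c, n ≤ c → a c = 0) (hb : ∀ c, n ≤ c → b c = 0) :
    rowV q s x a b = jump q s x (a 0 - b 0) * ∏ c ∈ Finset.range n,
      (jump q s x (a (c + 1) - b (c + 1)) * stay q s x (b c - a (c + 1)) *
        gap q s (b c - b (c + 1))) := by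
  rw [rowV, finprod_eq_prod_range_of_eq_one (n := n) fun c hc => ?_]
  simp [hb c hc, ha (c + 1) (by omega), hb (c + 1) (by omega)]

theorem rowT_eq_prod (hu : 1 + s * x ≠ 0) (ha : ∀ c, n ≤ c → a c = 0)
    (hb : ∀ c, n ≤ c → b c = 0) :
    rowT q s x a b = halfLead x (a 0 - b 0) * ∏ c ∈ Finset.range n,
      halfW q s x (b c - b (c + 1)) (a c - b c) (a (c + 1) - b (c + 1)) := by
  rw [rowT, finprod_eq_prod_range_of_eq_one (n := n) fun c hc => ?_]
  simp [ha c hc, hb c hc, ha (c + 1) (by omega), hb (c + 1) (by omega), halfW, hu]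

theorem of_rowU_ne_zero (ha : ∀ c, n ≤ c → a c = 0) (hb : ∀ c, n ≤ c → b c = 0)
    (h : rowU q s x a b ≠ 0) (c : ℕ) : b c ≤ a c ∧ a (c + 1) ≤ b c ∧ a (c + 1) ≤ a c := by
  rw [rowU_eq_prod ha hb, mul_ne_zero_iff, Finset.prod_ne_zero_iff] at h
  have key : ∀ c < n, b (c + 1) ≤ a (c + 1) ∧ a (c + 1) ≤ b c ∧ a (c + 1) ≤ a c := by
    intro c hc
    have h1 := h.2 c (Finset.mem_range.mpr hc)
    simp only [mul_ne_zero_iff] at h1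
    have h2 := nonneg_of_zext_ne_zero h1.1.1
    have h3 := nonneg_of_zext_ne_zero h1.1.2
    have h4 := nonneg_of_zext_ne_zero h1.2
    omega
  have key2 : b c ≤ a c := by
    rcases c with _ | c
    · have := nonneg_of_zext_ne_zero h.1; omega
    · by_cases hc : c < n
      · exact (key c hc).1
      · rw [ha _ (by omega), hb _ (by omega)]
  by_cases hc : c < n
  · exact ⟨key2, (key c hc).2⟩
  · simp [ha c (by omega), hb c (by omega), ha (c + 1) (by omega)]

theorem of_rowV_ne_zero (ha : ∀ c, n ≤ c → a c = 0) (hb : ∀ c, n ≤ c → b c = 0)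
    (h : rowV q s x a b ≠ 0) (c : ℕ) : b c ≤ a c ∧ a (c + 1) ≤ b c ∧ b (c + 1) ≤ b c := by
  rw [rowV_eq_prod ha hb, mul_ne_zero_iff, Finset.prod_ne_zero_iff] at h
  have key : ∀ c < n, b (c + 1) ≤ a (c + 1) ∧ a (c + 1) ≤ b c ∧ b (c + 1) ≤ b c := by
    intro c hc
    have h1 := h.2 c (Finset.mem_range.mpr hc)
    simp only [mul_ne_zero_iff] at h1
    have h2 := nonneg_of_zext_ne_zero h1.1.1
    have h3 := nonneg_of_zext_ne_zero h1.1.2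
    have h4 := nonneg_of_zext_ne_zero h1.2
    omega
  have key2 : b c ≤ a c := by
    rcases c with _ | c
    · have := nonneg_of_zext_ne_zero h.1; omega
    · by_cases hc : c < n
      · exact (key c hc).1
      · rw [ha _ (by omega), hb _ (by omega)]
  by_cases hc : c < n
  · exact ⟨key2, (key c hc).2⟩
  · simp [ha c (by omega), hb c (by omega), ha (c + 1) (by omega), hb (c + 1) (by omega)]

theorem of_rowT_ne_zero (hu : 1 + s * x ≠ 0) (ha : ∀ c, n ≤ c → a c = 0)
    (hb : ∀ c, n ≤ c → b c = 0) (h : rowT q s x a b ≠ 0) (c : ℕ) :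
    a c - b c = 0 ∨ a c - b c = 1 := by
  rw [rowT_eq_prod hu ha hb, mul_ne_zero_iff, Finset.prod_ne_zero_iff] at h
  rcases c with _ | c
  · by_contra hcon
    apply h.1
    rw [halfLead]
    split_ifs <;> tauto
  · by_cases hc : c < n
    · have h1 := h.2 c (Finset.mem_range.mpr hc)
      by_contra hcon
      apply h1
      rw [halfW]
      split_ifs <;> first | tauto | simp
    · left
      rw [ha _ (by omega), hb _ (by omega), sub_zero]

end

/-! ### Sums over paths with two states -/

/-- The indicator of a finite set of positions. -/
def ind (S : Finset ℕ) (c : ℕ) : ℤ := if c ∈ S then 1 else 0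

/-- The row vector `v A_0 ⋯ A_{n-1}`, for `2 × 2` matrices `A_c` indexed by `{0, 1}`. -/
noncomputable def pathVec (A : ℕ → ℤ → ℤ → ℂ) (v : ℤ → ℂ) : ℕ → ℤ → ℂ
  | 0 => v
  | n + 1 => fun e' => pathVec A v n 0 * A n 0 e' + pathVec A v n 1 * A n 1 e'

theorem sum_powerset_range_succ_path (A : ℕ → ℤ → ℤ → ℂ) (v : ℤ → ℂ) (n : ℕ) (u : ℤ → ℂ) :
    ∑ S ∈ (Finset.range (n + 1)).powerset, v (ind S 0) *
      (∏ c ∈ Finset.range n, A c (ind S c) (ind S (c + 1))) * u (ind S n) =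
    pathVec A v n 0 * u 0 + pathVec A v n 1 * u 1 := by
  induction n generalizing u with
  | zero =>
    rw [Finset.range_add_one, Finset.sum_powerset_insert (by simp)]
    simp [ind, pathVec]
  | succ n ih =>
    rw [Finset.range_add_one, Finset.sum_powerset_insert (by simp), ← Finset.sum_add_distrib]
    have key : ∀ S ∈ (Finset.range (n + 1)).powerset,
        v (ind S 0) * (∏ c ∈ Finset.range (n + 1), A c (ind S c) (ind S (c + 1))) *
            u (ind S (n + 1)) +
          v (ind (insert (n + 1) S) 0) * (∏ c ∈ Finset.range (n + 1),
            A c (ind (insert (n + 1) S) c) (ind (insert (n + 1) S) (c + 1))) *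
              u (ind (insert (n + 1) S) (n + 1)) =
        v (ind S 0) * (∏ c ∈ Finset.range n, A c (ind S c) (ind S (c + 1))) *
          (A n (ind S n) 0 * u 0 + A n (ind S n) 1 * u 1) := by
      intro S hS
      have hS' : ∀ c, n + 1 ≤ c → c ∉ S := fun c hc h => by
        have := Finset.mem_range.mp (Finset.mem_powerset.mp hS h); omega
      have e1 : ∀ c ≤ n, ind (insert (n + 1) S) c = ind S c := fun c hc => by
        have : c ≠ n + 1 := by omega
        simp [ind, this]
      have e2 : ind S (n + 1) = 0 := by simp [ind, hS' (n + 1) le_rfl]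
      have e3 : ind (insert (n + 1) S) (n + 1) = 1 := by simp [ind]
      have e4 : ∏ c ∈ Finset.range n, A c (ind (insert (n + 1) S) c)
            (ind (insert (n + 1) S) (c + 1)) =
          ∏ c ∈ Finset.range n, A c (ind S c) (ind S (c + 1)) :=
        Finset.prod_congr rfl fun c hc => by
          have := Finset.mem_range.mp hc
          rw [e1 c (by omega), e1 (c + 1) (by omega)]
      rw [Finset.prod_range_succ, Finset.prod_range_succ, e4, e2, e3, e1 n le_rfl,
        e1 0 (Nat.zero_le _)]
      ring
    rw [Finset.sum_congr rfl key, ih (fun e => A n e 0 * u 0 + A n e 1 * u 1)]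
    simp only [pathVec]
    ring

/-- The sum over `S` of the products of `A_c` along the path `ind S`, which ends in state `0`. -/
theorem sum_powerset_range_path (A : ℕ → ℤ → ℤ → ℂ) (v : ℤ → ℂ) (n : ℕ) :
    ∑ S ∈ (Finset.range n).powerset, v (ind S 0) *
      (∏ c ∈ Finset.range n, A c (ind S c) (ind S (c + 1))) = pathVec A v n 0 := by
  rcases n with _ | n
  · simp [ind, pathVec]
  · have := sum_powerset_range_succ_path A v n fun e => A n e 0
    refine Eq.trans ?_ this
    refine Finset.sum_congr rfl fun S hS => ?_
    have e2 : ind S (n + 1) = 0 := by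
      have : n + 1 ∉ S := fun h => by
        have := Finset.mem_range.mp (Finset.mem_powerset.mp hS h); omega
      simp [ind, this]
    rw [Finset.prod_range_succ, e2]
    ring

/-! ### Sums over partitions as sums over paths -/

theorem parts_injective : Function.Injective parts := by
  intro a b h
  ext ⟨i, j⟩
  have h1 : a.rowLen i = b.rowLen i := by simpa [parts] using congrFun h i
  rw [YoungDiagram.mem_cells, YoungDiagram.mem_cells, YoungDiagram.mem_iff_lt_rowLen, h1,
    YoungDiagram.mem_iff_lt_rowLen]

theorem parts_nonneg (lam : YoungDiagram) (c : ℕ) : 0 ≤ parts lam c := Int.natCast_nonneg _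

theorem parts_anti (lam : YoungDiagram) (c : ℕ) : parts lam (c + 1) ≤ parts lam c := by
  have := lam.rowLen_anti c (c + 1) (by omega)
  simpa [parts] using this

theorem parts_eq_zero_of_le {lam : YoungDiagram} {n : ℕ} (h : lam.rowLen n = 0) (c : ℕ)
    (hc : n ≤ c) : parts lam c = 0 := by
  have := lam.rowLen_anti n c hc
  simp only [parts]
  omega

theorem exists_rowLen_eq_zero (lam : YoungDiagram) : ∃ n, lam.rowLen n = 0 := by
  refine ⟨lam.colLen 0, ?_⟩
  by_contra h
  have h1 : (lam.colLen 0, 0) ∈ lam := YoungDiagram.mem_iff_lt_rowLen.mpr (by omega)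
  have := YoungDiagram.mem_iff_lt_colLen.mp h1
  omega

theorem rowLen_eq_zero_of_le {lam : YoungDiagram} {n m : ℕ} (h : lam.rowLen n = 0) (hm : n ≤ m) :
    lam.rowLen m = 0 := by
  have := lam.rowLen_anti n m hm
  omega

theorem rowLen_bot (c : ℕ) : (⊥ : YoungDiagram).rowLen c = 0 := by
  by_contra h
  exact YoungDiagram.notMem_bot _ (YoungDiagram.mem_iff_lt_rowLen.mpr (Nat.pos_of_ne_zero h))

theorem parts_bot (c : ℕ) : parts ⊥ c = 0 := by simp [parts, rowLen_bot]

/-- Weakly decreasing integer sequences which are eventually zero are partitions. -/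
theorem exists_parts_eq {a : ℕ → ℤ} {n : ℕ} (ha : ∀ c, n ≤ c → a c = 0)
    (hanti : ∀ c, a (c + 1) ≤ a c) : ∃ lam, parts lam = a := by
  have hanti' : Antitone a := antitone_nat_of_succ_le hanti
  let lam : YoungDiagram :=
    { cells := ((Finset.range n) ×ˢ (Finset.range (a 0).toNat)).filter
        fun c => (c.2 : ℤ) < a c.1
      isLowerSet := by
        rintro ⟨i, j⟩ ⟨i', j'⟩ hle hmem
        have h1 : i' ≤ i := hle.1
        have h2 : j' ≤ j := hle.2
        simp only [Finset.coe_filter, Finset.mem_product, Finset.mem_range, Set.mem_ofPred_eq]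
          at hmem ⊢
        have := hanti' h1
        omega }
  have hmem : ∀ i j, (i, j) ∈ lam ↔ (j : ℤ) < a i := by
    intro i j
    change (i, j) ∈ Finset.filter _ _ ↔ _
    simp only [Finset.mem_filter, Finset.mem_product, Finset.mem_range, and_iff_right_iff_imp]
    intro h
    have h1 := hanti' (Nat.zero_le i)
    by_cases hi : n ≤ i
    · have := ha i hi; omega
    · omega
  refine ⟨lam, funext fun c => ?_⟩
  have h0 : 0 ≤ a c := by
    have := hanti' (le_max_left c n)
    rwa [ha _ (le_max_right c n)] at this
  have h1 := fun j => (YoungDiagram.mem_iff_lt_rowLen (μ := lam) (i := c) (j := j)).symm.trans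
    (hmem c j)
  have h2 := h1 (lam.rowLen c)
  have h3 := h1 (a c).toNat
  simp only [parts]
  omega

/-- A sum over partitions whose support lies in a family `φ S` of integer sequences, indexed by
subsets `S` of `{0, …, n - 1}`, is the sum over the family, if the terms vanish for those `φ S`
which are not partitions. -/
theorem hasSum_of_parts_eq {g : YoungDiagram → ℂ} {f : Finset ℕ → ℂ} {n : ℕ}
    {φ : Finset ℕ → ℕ → ℤ} (hφ : Function.Injective φ)
    (h1 : ∀ lam, g lam ≠ 0 → ∃ S ∈ (Finset.range n).powerset, parts lam = φ S)
    (h2 : ∀ S ∈ (Finset.range n).powerset, f S ≠ 0 → ∃ lam, parts lam = φ S)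
    (h3 : ∀ lam S, parts lam = φ S → g lam = f S) :
    HasSum g (∑ S ∈ (Finset.range n).powerset, f S) := by
  classical
  set P := (Finset.range n).powerset.filter fun S => f S ≠ 0 with hP
  choose! L hL using h2
  have hL' : ∀ S ∈ P, parts (L S) = φ S := fun S hS =>
    hL S (Finset.mem_filter.mp hS).1 (Finset.mem_filter.mp hS).2
  have e : ∑ S ∈ (Finset.range n).powerset, f S = ∑ lam ∈ P.image L, g lam := by
    rw [Finset.sum_image, ← Finset.sum_filter_ne_zero]
    · exact Finset.sum_congr rfl fun S hS => (h3 _ _ (hL' S hS)).symm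
    · intro S hS S' hS' hSS
      apply hφ
      rw [← hL' S hS, ← hL' S' hS', hSS]
  rw [e]
  refine hasSum_sum_of_ne_finset_zero fun lam hlam => ?_
  by_contra hne
  obtain ⟨S, hS, hlS⟩ := h1 lam hne
  have hfS : f S ≠ 0 := by rwa [← h3 _ _ hlS]
  refine hlam (Finset.mem_image.mpr ⟨S, Finset.mem_filter.mpr ⟨hS, hfS⟩, ?_⟩)
  apply parts_injective
  rw [hlS, hL S hS hfS]

theorem ind_injective : Function.Injective ind := by
  intro S S' h
  ext c
  have := congrFun h c
  simp only [ind] at this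
  split_ifs at this <;> simp_all

theorem ind_eq_zero {S : Finset ℕ} {n : ℕ} (hS : S ∈ (Finset.range n).powerset) {c : ℕ}
    (hc : n ≤ c) : ind S c = 0 := by
  refine if_neg fun h => ?_
  have := Finset.mem_range.mp (Finset.mem_powerset.mp hS h)
  omega

theorem exists_eq_ind {d : ℕ → ℤ} (n : ℕ) (h : ∀ c, d c = 0 ∨ d c = 1)
    (hn : ∀ c, n ≤ c → d c = 0) : ∃ S ∈ (Finset.range n).powerset, d = ind S := by
  refine ⟨(Finset.range n).filter fun c => d c = 1, by simp, funext fun c => ?_⟩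
  simp only [ind, Finset.mem_filter, Finset.mem_range]
  rcases h c with h' | h'
  · simp [h']
  · have : c < n := by
      by_contra hc
      rw [hn c (by omega)] at h'
      exact zero_ne_one h'
    simp [h', this]

/-! ### Fusion -/

section
variable {q s : ℂ}

/-- A row of `halfW` vertices with parameter `x` on top of a row with parameter `x` is a row with
parameter `q x`. -/
theorem hasSum_rowT_mul_rowU (hq : ‖q‖ < 1) (hs : ‖s‖ < 1) {x : ℂ} (hx : ‖x‖ < 1)
    (lam mu : YoungDiagram) :
    HasSum (fun nu => rowT q s x (parts lam) (parts nu) * rowU q s x (parts nu) (parts mu))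
      (rowU q s (q * x) (parts lam) (parts mu)) := by
  have hu := one_add_mul_ne_zero hs hx
  obtain ⟨n1, hn1⟩ := exists_rowLen_eq_zero lam
  obtain ⟨n2, hn2⟩ := exists_rowLen_eq_zero mu
  obtain ⟨n, hnn1, hnn2⟩ : ∃ n, n1 ≤ n ∧ n2 ≤ n := ⟨max n1 n2, by simp, by simp⟩
  have hl := parts_eq_zero_of_le (rowLen_eq_zero_of_le hn1 hnn1)
  have hm := parts_eq_zero_of_le (rowLen_eq_zero_of_le hn2 hnn2)
  have hanti := parts_anti lam
  generalize parts lam = l at *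
  have hmu := parts_nonneg mu
  generalize parts mu = m at *
  set v : ℤ → ℂ := fun e => halfLead x e * jump q s x (l 0 - m 0 - e) with hv
  set A : ℕ → ℤ → ℤ → ℂ := fun c e e' => halfW q s x (l c - l (c + 1) - e + e') e e' *
    (jump q s x (l (c + 1) - m (c + 1) - e') * stay q s x (m c - l (c + 1) + e') *
      gap q s (l c - l (c + 1) - e + e')) with hA
  have hφ : ∀ S ∈ (Finset.range n).powerset, ∀ c, n ≤ c → l c - ind S c = 0 := fun S hS c hc => by
    rw [hl c hc, ind_eq_zero hS hc, sub_zero]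
  have hterm : ∀ S ∈ (Finset.range n).powerset,
      rowT q s x l (fun c => l c - ind S c) * rowU q s x (fun c => l c - ind S c) m =
        v (ind S 0) * ∏ c ∈ Finset.range n, A c (ind S c) (ind S (c + 1)) := by
    intro S hS
    rw [rowT_eq_prod hu hl (hφ S hS), rowU_eq_prod (hφ S hS) hm, mul_mul_mul_comm,
      ← Finset.prod_mul_distrib]
    have e : ∀ c, l c - ind S c - (l (c + 1) - ind S (c + 1)) =
        l c - l (c + 1) - ind S c + ind S (c + 1) := fun c => by ring
    have e2 : ∀ c, l c - ind S c - m c = l c - m c - ind S c := fun c => by ring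
    have e3 : ∀ c, m c - (l (c + 1) - ind S (c + 1)) = m c - l (c + 1) + ind S (c + 1) :=
      fun c => by ring
    simp only [hv, hA, sub_sub_cancel, e, e2, e3]
  -- the vector `e ↦ halfLead x e * jump q s x (l k - m k - e)` moves through the columns
  have hpath : ∀ k, ∀ e', e' = 0 ∨ e' = 1 → pathVec A v k e' =
      (∏ c ∈ Finset.range k, (jump q s (q * x) (l c - m c) * stay q s (q * x) (m c - l (c + 1)) *
        gap q s (l c - l (c + 1)))) * (halfLead x e' * jump q s x (l k - m k - e')) := by
    intro k
    induction k with
    | zero => intro e' _; simp [pathVec, hv]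
    | succ k ih =>
      intro e' he'
      have hc := fusion_column hq hs hx (l (k + 1) - m (k + 1))
        (show l k - l (k + 1) = (l k - m k) + (m k - l (k + 1)) by ring)
        (by have := hanti k; omega) he'
      simp only [pathVec]
      rw [ih 0 (Or.inl rfl), ih 1 (Or.inr rfl), Finset.prod_range_succ, mul_assoc (∏ _ ∈ _, _) _
        (halfLead x e' * _), ← hc]
      simp only [hA, sub_zero]
      ring
  have hval : rowU q s (q * x) l m = ∑ S ∈ (Finset.range n).powerset,
      rowT q s x l (fun c => l c - ind S c) * rowU q s x (fun c => l c - ind S c) m := by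
    rw [Finset.sum_congr rfl hterm, sum_powerset_range_path, hpath n 0 (Or.inl rfl),
      rowU_eq_prod hl hm, hl n le_rfl, hm n le_rfl]
    simp only [Finset.prod_mul_distrib, halfLead_zero, sub_zero, jump_zero, mul_one]
    have e1 := Finset.prod_range_succ (fun c => jump q s (q * x) (l c - m c)) n
    rw [Finset.prod_range_succ'] at e1
    rw [hl n le_rfl, hm n le_rfl, sub_zero, jump_zero, mul_one] at e1
    rw [← e1]
    ring
  rw [hval]
  refine hasSum_of_parts_eq (φ := fun S c => l c - ind S c) ?_ ?_ ?_ ?_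
  · intro S S' h
    exact ind_injective (funext fun c => by have := congrFun h c; simpa using this)
  · intro nu hne
    obtain ⟨n3, hn3⟩ := exists_rowLen_eq_zero nu
    have hnu0 := parts_eq_zero_of_le hn3
    have hnn := parts_nonneg nu
    generalize parts nu = v at *
    have h01 := of_rowT_ne_zero (n := max n n3) hu (fun c hc => hl c (by omega))
      (fun c hc => hnu0 c (by omega)) (left_ne_zero_of_mul hne)
    obtain ⟨S, hS, hd⟩ := exists_eq_ind n h01 fun c hc => by
      have h1 := h01 c
      have h2 := hl c hc
      have h3 := hnn c
      omega
    refine ⟨S, hS, funext fun c => ?_⟩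
    have := congrFun hd c
    omega
  · intro S hS hne
    refine exists_parts_eq (hφ S hS) fun c => ?_
    exact (of_rowU_ne_zero (hφ S hS) hm (right_ne_zero_of_mul hne) c).2.2
  · intro nu S h
    simp only [h]

/-! ### Exchange relation -/

/-- Rows of `halfW` vertices commute up to a scalar with the operation dual to adding a row. -/
theorem exchange (hq : ‖q‖ < 1) (hs : ‖s‖ < 1) {x : ℂ} (hx : ‖x‖ < 1) (y : ℂ)
    (mu nu : YoungDiagram) :
    HasSum (fun lam => rowV q s y (parts lam) (parts nu) * rowT q s x (parts lam) (parts mu))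
      ((1 - x * y) / (1 + s * x) * ∑' kap, rowT q s x (parts nu) (parts kap) *
        rowV q s y (parts mu) (parts kap)) := by
  have hu := one_add_mul_ne_zero hs hx
  obtain ⟨n1, hn1⟩ := exists_rowLen_eq_zero mu
  obtain ⟨n2, hn2⟩ := exists_rowLen_eq_zero nu
  obtain ⟨k, hnn1, hnn2⟩ : ∃ n, n1 ≤ n ∧ n2 ≤ n := ⟨max n1 n2, by simp, by simp⟩
  have hm' := parts_eq_zero_of_le (rowLen_eq_zero_of_le hn1 hnn1)
  have hv' := parts_eq_zero_of_le (rowLen_eq_zero_of_le hn2 hnn2)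
  have hmanti := parts_anti mu
  have hvanti := parts_anti nu
  have hv0 := parts_nonneg nu
  generalize parts mu = m at *
  generalize parts nu = v at *
  -- one column more than the lengths of `μ` and `ν`: the sum may have one part more
  set n := k + 1 with hn
  have hm : ∀ c, n ≤ c → m c = 0 := fun c hc => hm' c (by omega)
  have hv : ∀ c, n ≤ c → v c = 0 := fun c hc => hv' c (by omega)
  set i : ℤ → ℂ := fun e => halfLead x e * jump q s y (m 0 - v 0 + e) with hi
  set A : ℕ → ℤ → ℤ → ℂ := fun c e e' => halfW q s x (m c - m (c + 1)) e e' *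
    (jump q s y (m (c + 1) - v (c + 1) + e') * stay q s y (v c - m (c + 1) - e') *
      gap q s (v c - v (c + 1))) with hA
  set B : ℕ → ℤ → ℤ → ℂ := fun c e e' => halfW q s x (v c - v (c + 1) - e + e') e e' *
    (jump q s y (m (c + 1) - v (c + 1) + e') * stay q s y (v c - m (c + 1) - e) *
      gap q s (v c - v (c + 1) - e + e')) with hB
  have hφA : ∀ S ∈ (Finset.range n).powerset, ∀ c, n ≤ c → m c + ind S c = 0 := fun S hS c hc => by
    rw [hm c hc, ind_eq_zero hS hc, add_zero]
  have hφB : ∀ S ∈ (Finset.range n).powerset, ∀ c, n ≤ c → v c - ind S c = 0 := fun S hS c hc => by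
    rw [hv c hc, ind_eq_zero hS hc, sub_zero]
  have htermA : ∀ S ∈ (Finset.range n).powerset,
      rowV q s y (fun c => m c + ind S c) v * rowT q s x (fun c => m c + ind S c) m =
        i (ind S 0) * ∏ c ∈ Finset.range n, A c (ind S c) (ind S (c + 1)) := by
    intro S hS
    rw [rowT_eq_prod hu (hφA S hS) hm, rowV_eq_prod (hφA S hS) hv, mul_mul_mul_comm,
      ← Finset.prod_mul_distrib]
    have e2 : ∀ c, m c + ind S c - v c = m c - v c + ind S c := fun c => by ring
    have e3 : ∀ c, v c - (m (c + 1) + ind S (c + 1)) = v c - m (c + 1) - ind S (c + 1) :=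
      fun c => by ring
    simp only [hi, hA, add_sub_cancel_left, e2, e3]
    rw [mul_comm (jump _ _ _ _) (halfLead _ _)]
    congr 1
    exact Finset.prod_congr rfl fun c _ => by ring
  have htermB : ∀ S ∈ (Finset.range n).powerset,
      rowT q s x v (fun c => v c - ind S c) * rowV q s y m (fun c => v c - ind S c) =
        i (ind S 0) * ∏ c ∈ Finset.range n, B c (ind S c) (ind S (c + 1)) := by
    intro S hS
    rw [rowT_eq_prod hu hv (hφB S hS), rowV_eq_prod hm (hφB S hS), mul_mul_mul_comm,
      ← Finset.prod_mul_distrib]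
    have e : ∀ c, v c - ind S c - (v (c + 1) - ind S (c + 1)) =
        v c - v (c + 1) - ind S c + ind S (c + 1) := fun c => by ring
    have e2 : ∀ c, m c - (v c - ind S c) = m c - v c + ind S c := fun c => by ring
    have e3 : ∀ c, v c - ind S c - m (c + 1) = v c - m (c + 1) - ind S c := fun c => by ring
    simp only [hi, hB, sub_sub_cancel, e, e2, e3]
  -- where the row `e` of `crossW` is not meaningful, the left vector vanishes
  have hvan : ∀ c e, e = 0 ∨ e = 1 → m c - v c + e < 0 → pathVec A i c e = 0 := by
    intro c e he hneg
    rcases c with _ | c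
    · simp [pathVec, hi, jump_of_neg _ hneg]
    · simp only [pathVec, hA, jump_of_neg (q := q) (s := s) y hneg]
      ring
  have hpath : ∀ c, ∀ f, f = 0 ∨ f = 1 →
      pathVec A i c 0 * crossW q s x y (m c - v c) 0 f +
        pathVec A i c 1 * crossW q s x y (m c - v c) 1 f = (1 - x * y) * pathVec B i c f := by
    intro c
    induction c with
    | zero =>
      intro f hf
      simp only [pathVec, hi, halfLead_zero, halfLead_one, add_zero]
      generalize m 0 - v 0 = d
      obtain hd | hd := lt_or_ge d (-1)
      · rw [jump_of_neg _ (show d < 0 by omega), jump_of_neg _ (show d + 1 < 0 by omega),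
          jump_of_neg _ (show d + f < 0 by omega)]
        ring
      obtain rfl | hd := eq_or_lt_of_le hd
      · rcases hf with rfl | rfl <;> simp [crossW, jump_of_neg, mul_comm]
      · lift d to ℕ using (by omega)
        obtain ⟨z, z0, z1⟩ := exists_jump_eq (s := s) hq y d
        rcases hf with rfl | rfl
        · simp only [add_zero, z0, z1, crossW_zero_zero, crossW_one_zero, halfLead_zero,
            Int.toNat_natCast_add_one]
          ring
        · simp only [z0, z1, crossW_zero_one, crossW_one_one, halfLead_one,
            Int.toNat_natCast_add_one]
          ring
    | succ c ih =>
      intro f hf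
      have ih0 := ih 0 (Or.inl rfl)
      have ih1 := ih 1 (Or.inr rfl)
      have hcol : ∀ e, e = 0 ∨ e = 1 → pathVec A i c e *
          (A c e 0 * crossW q s x y (m (c + 1) - v (c + 1)) 0 f +
            A c e 1 * crossW q s x y (m (c + 1) - v (c + 1)) 1 f) =
          pathVec A i c e * (crossW q s x y (m c - v c) e 0 * B c 0 f +
            crossW q s x y (m c - v c) e 1 * B c 1 f) := by
        intro e he
        by_cases hneg : m c - v c + e < 0
        · rw [hvan c e he hneg, zero_mul, zero_mul]
        · have := exchange_column hq hs y hx (d := m c - v c) (d' := m (c + 1) - v (c + 1))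
            (p := v c - m (c + 1)) (m := m c - m (c + 1)) (n := v c - v (c + 1)) (by ring) (by ring)
            (by have := hmanti c; omega) (by have := hvanti c; omega) he hf (by omega)
          congr 1
          simp only [hA, hB, add_zero, sub_zero]
          exact this
      have h0 := hcol 0 (Or.inl rfl)
      have h1 := hcol 1 (Or.inr rfl)
      simp only [pathVec]
      linear_combination h0 + h1 + B c 0 f * ih0 + B c 1 f * ih1
  have hAB : (1 + s * x) * pathVec A i n 0 = (1 - x * y) * pathVec B i n 0 := by
    -- interlacing forces `λ_n ≤ ν_{n-1} = 0`, so the edge state `1` is excluded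
    have h1 : pathVec A i n 1 = 0 := by
      simp only [hn, pathVec, hA, hv' k le_rfl, hm' (k + 1) (by omega)]
      rw [stay_of_neg (q := q) (s := s) y (show (0 : ℤ) - 0 - 1 < 0 by omega)]
      ring
    have h2 := hpath n 0 (Or.inl rfl)
    rw [h1, hm n le_rfl, hv n le_rfl, zero_mul, add_zero] at h2
    rw [← h2]
    simp [crossW]
    ring
  have hsumB : HasSum (fun kap => rowT q s x v (parts kap) * rowV q s y m (parts kap))
      (pathVec B i n 0) := by
    rw [← sum_powerset_range_path, ← Finset.sum_congr rfl htermB]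
    refine hasSum_of_parts_eq (φ := fun S c => v c - ind S c) ?_ ?_ ?_ ?_
    · intro S S' h
      exact ind_injective (funext fun c => by have := congrFun h c; simpa using this)
    · intro kap hne
      obtain ⟨n3, hn3⟩ := exists_rowLen_eq_zero kap
      have hk0 := parts_eq_zero_of_le hn3
      have hkn := parts_nonneg kap
      generalize parts kap = l at *
      have h01 := of_rowT_ne_zero (n := max n n3) hu (fun c hc => hv c (by omega))
        (fun c hc => hk0 c (by omega)) (left_ne_zero_of_mul hne)
      obtain ⟨S, hS, hd⟩ := exists_eq_ind n h01 fun c hc => by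
        have h1 := h01 c
        have h2 := hv c hc
        have h3 := hkn c
        omega
      refine ⟨S, hS, funext fun c => ?_⟩
      have := congrFun hd c
      omega
    · intro S hS hne
      refine exists_parts_eq (hφB S hS) fun c => ?_
      exact (of_rowV_ne_zero hm (hφB S hS) (right_ne_zero_of_mul hne) c).2.2
    · intro nu S h
      simp only [h]
  have hsumA : HasSum (fun lam => rowV q s y (parts lam) v * rowT q s x (parts lam) m)
      (pathVec A i n 0) := by
    rw [← sum_powerset_range_path, ← Finset.sum_congr rfl htermA]
    refine hasSum_of_parts_eq (φ := fun S c => m c + ind S c) ?_ ?_ ?_ ?_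
    · intro S S' h
      exact ind_injective (funext fun c => by have := congrFun h c; simpa using this)
    · intro lam hne
      obtain ⟨n3, hn3⟩ := exists_rowLen_eq_zero lam
      have hk0 := parts_eq_zero_of_le hn3
      have hkn := parts_nonneg lam
      generalize parts lam = l at *
      have h01 := of_rowT_ne_zero (n := max n n3) hu (fun c hc => hk0 c (by omega))
        (fun c hc => hm c (by omega)) (right_ne_zero_of_mul hne)
      have hV := of_rowV_ne_zero (n := max n n3) (fun c hc => hk0 c (by omega))
        (fun c hc => hv c (by omega)) (left_ne_zero_of_mul hne)
      obtain ⟨S, hS, hd⟩ := exists_eq_ind n h01 fun c hc => by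
        obtain ⟨c, rfl⟩ : ∃ c', c = c' + 1 := ⟨c - 1, by omega⟩
        have h1 := (hV c).2.1
        have h2 := hv' c (by omega)
        have h3 := hkn (c + 1)
        have h4 := hm _ hc
        omega
      refine ⟨S, hS, funext fun c => ?_⟩
      have := congrFun hd c
      omega
    · intro S hS hne
      refine exists_parts_eq (hφA S hS) fun c => ?_
      have := of_rowV_ne_zero (hφA S hS) hv (left_ne_zero_of_mul hne) c
      exact this.2.1.trans this.1
    · intro nu S h
      simp only [h]
  rw [hsumB.tsum_eq, div_mul_eq_mul_div, ← hAB, mul_div_cancel_left₀ _ hu]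
  exact hsumA
end

/-! ### Branching -/

section
variable {q s : ℂ}

theorem hasSum_of_eq {ι : Type*} {f g : ι → ℂ} {a : ℂ} (h : ∀ i, f i = g i) (hg : HasSum g a) :
    HasSum f a := by
  rwa [funext h]

theorem state_eq (lam : YoungDiagram) (c : ℕ) :
    (state lam c : ℤ) = parts lam c - parts lam (c + 1) := by
  have := lam.rowLen_anti c (c + 1) (by omega)
  rw [state_apply]
  simp only [parts]
  omega

theorem state_bot : state ⊥ = 0 := by
  ext c
  simp [state_apply, rowLen_bot]

theorem eq_of_sub_succ_eq {a b : ℕ → ℤ} {n : ℕ} (ha : ∀ c, n ≤ c → a c = 0)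
    (hb : ∀ c, n ≤ c → b c = 0) (h : ∀ c, a c - a (c + 1) = b c - b (c + 1)) : a = b := by
  have key : ∀ k c, a (c + k) - b (c + k) = a c - b c := by
    intro k c
    induction k with
    | zero => rfl
    | succ k ih =>
      have := h (c + k)
      rw [← add_assoc]
      omega
  funext c
  have := key n c
  rw [ha _ (by omega), hb _ (by omega)] at this
  omega

theorem state_injective : Function.Injective state := by
  intro lam mu h
  obtain ⟨n1, hn1⟩ := exists_rowLen_eq_zero lam
  obtain ⟨n2, hn2⟩ := exists_rowLen_eq_zero mu
  refine parts_injective (eq_of_sub_succ_eq (n := max n1 n2)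
    (fun c hc => parts_eq_zero_of_le hn1 c (by omega))
    (fun c hc => parts_eq_zero_of_le hn2 c (by omega)) fun c => ?_)
  rw [← state_eq, ← state_eq, h]

theorem state_surjective : Function.Surjective state := by
  intro f
  obtain ⟨M, hM⟩ := finsupp_bound f
  have hstep : ∀ c, ∑ i ∈ Finset.Ico c M, (f i : ℤ) =
      f c + ∑ i ∈ Finset.Ico (c + 1) M, (f i : ℤ) := by
    intro c
    by_cases hc : c < M
    · rw [Finset.sum_eq_sum_Ico_succ_bot hc]
    · simp [hM c (by omega), Finset.Ico_eq_empty_of_le (show M ≤ c by omega),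
        Finset.Ico_eq_empty_of_le (show M ≤ c + 1 by omega)]
  obtain ⟨lam, hlam⟩ := exists_parts_eq (a := fun c => ∑ i ∈ Finset.Ico c M, (f i : ℤ)) (n := M)
    (fun c hc => by simp [Finset.Ico_eq_empty_of_le hc]) (fun c => by have := hstep c; omega)
  refine ⟨lam, Finsupp.ext fun c => ?_⟩
  have h1 := state_eq lam c
  have h2 := hstep c
  simp only [hlam] at h1
  omega

/-- Partitions correspond to the states of the vertical edges between two rows. -/
noncomputable def stateEquiv : YoungDiagram ≃ (ℕ →₀ ℕ) :=
  Equiv.ofBijective state ⟨state_injective, state_surjective⟩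

/-- The vertex weights in terms of partitions, for the horizontal states `λ - μ`. A `λ` which does
not interlace with `μ` has weight zero on both sides. -/
theorem W_eq (x : ℂ) {lam mu : YoungDiagram} {h : ℕ → ℕ}
    (hh : ∀ c, (h c : ℤ) = parts lam c - parts mu c) (c : ℕ) :
    W q s x (state mu c) (h c) (state lam c) (h (c + 1)) =
      jump q s x (parts lam (c + 1) - parts mu (c + 1)) *
        stay q s x (parts mu c - parts lam (c + 1)) *
          gap q s (parts lam c - parts lam (c + 1)) := by
  have h1 := state_eq mu c
  have h2 := state_eq lam c
  have h3 := hh c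
  have h4 := hh (c + 1)
  by_cases hle : h (c + 1) ≤ state mu c
  · have h5 : parts mu c - parts lam (c + 1) = ((state mu c - h (c + 1) : ℕ) : ℤ) := by omega
    rw [W, if_pos ⟨by omega, hle⟩, ← h4, ← h2, h5, jump, stay, gap, zext_natCast, zext_natCast,
      zext_natCast, div_mul_div_comm, div_mul_div_comm]
  · rw [W, if_neg fun h => hle h.2, stay_of_neg _ (by omega)]
    ring

theorem WInf_eq (x : ℂ) (l : ℕ) :
    WInf q s x l = qPochInf (-s * x) q / qPochInf (s ^ 2) q * jump q s x l := by
  rw [WInf, jump, zext_natCast, div_mul_div_comm]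
  ring

/-- The sum over the horizontal edges of one row; only the states `λ - μ` can contribute. -/
theorem hasSum_row (x : ℂ) (lam mu : YoungDiagram) :
    HasSum (fun h : ℕ →₀ ℕ => WInf q s x (h 0) *
        ∏ᶠ c, W q s x (state mu c) (h c) (state lam c) (h (c + 1)))
      (qPochInf (-s * x) q / qPochInf (s ^ 2) q * rowU q s x (parts lam) (parts mu)) := by
  obtain ⟨n1, hn1⟩ := exists_rowLen_eq_zero lam
  obtain ⟨n2, hn2⟩ := exists_rowLen_eq_zero mu
  have hl : ∀ c, max n1 n2 ≤ c → parts lam c = 0 := fun c hc =>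
    parts_eq_zero_of_le hn1 c (by omega)
  have hm : ∀ c, max n1 n2 ≤ c → parts mu c = 0 := fun c hc =>
    parts_eq_zero_of_le hn2 c (by omega)
  -- the horizontal states are determined by conservation at the vertices
  have key : ∀ h : ℕ →₀ ℕ, WInf q s x (h 0) *
      ∏ᶠ c, W q s x (state mu c) (h c) (state lam c) (h (c + 1)) ≠ 0 →
        ∀ c, (h c : ℤ) = parts lam c - parts mu c := by
    intro h hne
    obtain ⟨n3, hn3⟩ := finsupp_bound h
    have hcons : ∀ c, state mu c + h c = state lam c + h (c + 1) := by
      intro c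
      have h1 := right_ne_zero_of_mul hne
      rw [finprod_eq_prod _ (finite_mulSupport q s x _ _ _)] at h1
      by_contra hcon
      have hW : W q s x (state mu c) (h c) (state lam c) (h (c + 1)) = 0 :=
        if_neg fun h => hcon h.1
      refine Finset.prod_ne_zero_iff.mp h1 c ?_ hW
      simp [hW]
    have := eq_of_sub_succ_eq (a := fun c => (h c : ℤ)) (b := fun c => parts lam c - parts mu c)
      (n := max (max n1 n2) n3) (fun c hc => by simp [hn3 c (by omega)])
      (fun c hc => by simp [hl c (by omega), hm c (by omega)]) fun c => by
        have h1 := hcons c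
        have h2 := state_eq lam c
        have h3 := state_eq mu c
        omega
    exact congrFun this
  by_cases hle : ∀ c, parts mu c ≤ parts lam c
  · let h0 : ℕ →₀ ℕ := Finsupp.onFinset (Finset.range (max n1 n2))
      (fun c => (parts lam c - parts mu c).toNat) fun c hc => by
        by_contra hlt
        exact hc (by simp [hl c (by simpa using hlt), hm c (by simpa using hlt)])
    have hh0 : ∀ c, (h0 c : ℤ) = parts lam c - parts mu c := fun c =>
      Int.toNat_of_nonneg (by have := hle c; omega)
    have hval : WInf q s x (h0 0) *
        ∏ᶠ c, W q s x (state mu c) (h0 c) (state lam c) (h0 (c + 1)) =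
        qPochInf (-s * x) q / qPochInf (s ^ 2) q * rowU q s x (parts lam) (parts mu) := by
      simp only [W_eq x hh0]
      rw [WInf_eq, rowU, hh0, mul_assoc]
    rw [← hval]
    refine hasSum_single h0 fun h hne => ?_
    by_contra hcon
    exact hne (Finsupp.ext fun c => by have := key h hcon c; have := hh0 c; omega)
  · have hU : rowU q s x (parts lam) (parts mu) = 0 := by
      by_contra hne
      exact hle fun c => (of_rowU_ne_zero hl hm hne c).1
    rw [hU, mul_zero]
    have : ∀ h : ℕ →₀ ℕ, WInf q s x (h 0) *
        ∏ᶠ c, W q s x (state mu c) (h c) (state lam c) (h (c + 1)) = 0 := by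
      intro h
      by_contra hcon
      exact hle fun c => by have := key h hcon c; omega
    simp only [this]
    exact hasSum_zero

theorem hasSum_partitionFunction (lam mu : YoungDiagram) {n : ℕ} (x : Fin n → ℂ) :
    HasSum (fun C : Config n => open Classical in
        if C.vert 0 = state mu ∧ C.vert (Fin.last n) = state lam then C.weight q s x else 0)
      (partitionFunction q s lam mu x) := by
  have hfin : (Function.support fun C : Config n => open Classical in
      if C.vert 0 = state mu ∧ C.vert (Fin.last n) = state lam then C.weight q s x else 0).Finite :=
    (finite_support q s lam mu x).subset fun C hC => by
      simpa [and_assoc] using hC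
  have h : partitionFunction q s lam mu x = ∑' C : Config n, open Classical in
      if C.vert 0 = state mu ∧ C.vert (Fin.last n) = state lam then C.weight q s x else 0 := by
    rw [tsum_eq_finsum hfin]
    exact finsum_congr fun C => by rw [finsum_eq_if]
  rw [h]
  exact (summable_of_hasFiniteSupport hfin).hasSum

/-- The configuration obtained by adding a row on top. -/
def Config.snoc {n : ℕ} (C : Config n) (v h : ℕ →₀ ℕ) : Config (n + 1) where
  vert := Fin.snoc C.vert v
  hor := Fin.snoc C.hor h

theorem Config.weight_snoc {n : ℕ} (C : Config n) (v h : ℕ →₀ ℕ) (x : Fin (n + 1) → ℂ) :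
    (C.snoc v h).weight q s x = C.weight q s (fun i => x i.castSucc) *
      (WInf q s (x (Fin.last n)) (h 0) *
        ∏ᶠ c, W q s (x (Fin.last n)) (C.vert (Fin.last n) c) (h c) (v c) (h (c + 1))) := by
  unfold Config.weight Config.snoc
  rw [Fin.prod_univ_castSucc]
  simp only [Fin.snoc_castSucc, Fin.snoc_last, Fin.succ_castSucc, Fin.succ_last]

theorem hasSum_partitionFunction_succ (lam : YoungDiagram) {n : ℕ} (x : Fin (n + 1) → ℂ) :
    HasSum (fun mu => qPochInf (-s * x (Fin.last n)) q / qPochInf (s ^ 2) q *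
        rowU q s (x (Fin.last n)) (parts lam) (parts mu) *
          partitionFunction q s mu ⊥ fun i => x i.castSucc)
      (partitionFunction q s lam ⊥ x) := by
  classical
  have h0 := hasSum_partitionFunction (q := q) (s := s) lam ⊥ x
  let j : Config n × (ℕ →₀ ℕ) → Config (n + 1) := fun p => p.1.snoc (state lam) p.2
  have hj : Function.Injective j := by
    rintro ⟨⟨v, h⟩, k⟩ ⟨⟨v', h'⟩, k'⟩ e
    simp only [j, Config.snoc, Config.mk.injEq] at e
    obtain ⟨rfl, -⟩ := Fin.snoc_injective2 e.1
    obtain ⟨rfl, rfl⟩ := Fin.snoc_injective2 e.2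
    rfl
  rw [← hj.hasSum_iff] at h0
  swap
  · intro C hC
    refine if_neg fun hcon => hC ⟨(⟨fun r => C.vert r.castSucc, fun r => C.hor r.castSucc⟩,
      C.hor (Fin.last n)), ?_⟩
    obtain ⟨v, h⟩ := C
    simp only [j, Config.snoc, Config.mk.injEq, ← hcon.2]
    exact ⟨Fin.snoc_init_self v, Fin.snoc_init_self h⟩
  let φ : Config n → ℂ := fun C => (if C.vert 0 = state ⊥ then
      C.weight q s (fun i => x i.castSucc) else 0) *
        (qPochInf (-s * x (Fin.last n)) q / qPochInf (s ^ 2) q *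
          rowU q s (x (Fin.last n)) (parts lam) (parts (stateEquiv.symm (C.vert (Fin.last n)))))
  have h1 := h0.prod_fiberwise (g := φ) fun C => by
    have := (hasSum_row (q := q) (s := s) (x (Fin.last n)) lam
      (stateEquiv.symm (C.vert (Fin.last n)))).mul_left (if C.vert 0 = state ⊥ then
        C.weight q s (fun i => x i.castSucc) else 0)
    have e : state (stateEquiv.symm (C.vert (Fin.last n))) = C.vert (Fin.last n) :=
      stateEquiv.apply_symm_apply _
    rw [e] at this
    refine hasSum_of_eq (fun h => ?_) this
    simp only [Function.comp, j, Config.weight_snoc]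
    have e0 : (C.snoc (state lam) h).vert 0 = C.vert 0 := by
      rw [← Fin.castSucc_zero]
      exact Fin.snoc_castSucc (α := fun _ => ℕ →₀ ℕ) (state lam) C.vert 0
    have e1 : (C.snoc (state lam) h).vert (Fin.last (n + 1)) = state lam :=
      Fin.snoc_last (α := fun _ => ℕ →₀ ℕ) _ _
    rw [e0, e1]
    split_ifs <;> simp_all
  have h2 := h1.tsum_fiberwise fun C => stateEquiv.symm (C.vert (Fin.last n))
  refine hasSum_of_eq (fun mu => ?_) h2
  refine Eq.trans ?_ (tsum_subtype _ φ).symm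
  rw [← (hasSum_partitionFunction mu ⊥ fun i => x i.castSucc).tsum_eq,
    ← tsum_mul_left]
  refine tsum_congr fun C => ?_
  have e : stateEquiv.symm (C.vert (Fin.last n)) = mu ↔ C.vert (Fin.last n) = state mu := by
    rw [Equiv.symm_apply_eq]; rfl
  by_cases hC : C.vert (Fin.last n) = state mu
  · have hmem : C ∈ (fun C : Config n => stateEquiv.symm (C.vert (Fin.last n))) ⁻¹' {mu} :=
      e.mpr hC
    rw [Set.indicator_of_mem hmem]
    simp only [φ]
    rw [e.mpr hC]
    simp only [hC, and_true]
    ring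
  · have hmem : C ∉ (fun C : Config n => stateEquiv.symm (C.vert (Fin.last n))) ⁻¹' {mu} :=
      fun h => hC (e.mp h)
    rw [Set.indicator_of_notMem hmem, if_neg fun h => hC h.2, mul_zero]

theorem hasSum_F_succ (hq : ‖q‖ < 1) (hs : ‖s‖ < 1) (lam : YoungDiagram) {n : ℕ}
    {x : Fin (n + 1) → ℂ} (hx : ∀ i, ‖x i‖ < 1) :
    HasSum (fun mu => rowU q s (x (Fin.last n)) (parts lam) (parts mu) *
      F q s mu fun i => x i.castSucc) (F q s lam x) := by
  have h := (hasSum_partitionFunction_succ (q := q) (s := s) lam x).div_const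
    (∏ i, (qPochInf (-s * x i) q / qPochInf (s ^ 2) q))
  unfold F skewF
  refine hasSum_of_eq (fun mu => ?_) h
  rw [Fin.prod_univ_castSucc]
  have h1 := qPochInf_ne_zero (-s * x (Fin.last n)) q (norm_neg_mul_lt_one hs (hx _)) hq
  have h2 := qPochInf_ne_zero (s ^ 2) q (norm_sq_lt_one hs) hq
  rw [mul_comm (∏ i : Fin n, _), mul_assoc, mul_div_mul_left _ _ (div_ne_zero h1 h2),
    mul_div_assoc]

theorem F_zero (lam : YoungDiagram) (x : Fin 0 → ℂ) [Decidable (lam = ⊥)] :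
    F q s lam x = if lam = ⊥ then 1 else 0 := by
  have h := hasSum_partitionFunction (q := q) (s := s) lam ⊥ x
  have h' := hasSum_single (f := fun C : Config 0 => open Classical in
    if C.vert 0 = state ⊥ ∧ C.vert (Fin.last 0) = state lam then C.weight q s x else 0)
    ⟨fun _ => state ⊥, Fin.elim0⟩ fun C hC => if_neg fun hcon => hC (by
      obtain ⟨v, h⟩ := C
      rw [Config.mk.injEq]
      exact ⟨funext fun i => by rw [Fin.fin_one_eq_zero i]; exact hcon.1, Subsingleton.elim _ _⟩)
  have : F q s lam x = partitionFunction q s lam ⊥ x := by simp [F, skewF]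
  rw [this, h.unique h']
  simp [Config.weight, state_injective.eq_iff, eq_comm (a := (⊥ : YoungDiagram))]

theorem dualCoeff_eq (lam : YoungDiagram) :
    dualCoeff q s lam = ∏ᶠ c, (gap q s (parts lam c - parts lam (c + 1)))⁻¹ := by
  refine finprod_congr fun c => ?_
  rw [← state_eq, gap, zext_natCast, inv_div]

theorem dualCoeff_bot : dualCoeff q s ⊥ = 1 := by
  simp [dualCoeff, state_bot, qPoch]

theorem FDual_eq (lam : YoungDiagram) {n : ℕ} (x : Fin n → ℂ) :
    FDual q s lam x = dualCoeff q s lam * F q s lam x := by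
  rw [FDual, skewFDual, dualCoeff_bot, div_one, F]

theorem gap_ne_zero (hq : ‖q‖ < 1) (hs : ‖s‖ < 1) (k : ℕ) : gap q s k ≠ 0 := by
  rw [gap, zext_natCast]
  exact div_ne_zero (qPoch_ne_zero q q hq hq k) (qPoch_ne_zero _ q (norm_sq_lt_one hs) hq k)

theorem gap_parts_ne_zero (hq : ‖q‖ < 1) (hs : ‖s‖ < 1) (lam : YoungDiagram) (c : ℕ) :
    gap q s (parts lam c - parts lam (c + 1)) ≠ 0 := by
  rw [← state_eq]
  exact gap_ne_zero hq hs _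

theorem dualCoeff_eq_prod {lam : YoungDiagram} {n : ℕ} (hn : lam.rowLen n = 0) :
    dualCoeff q s lam =
      ∏ c ∈ Finset.range n, (gap q s (parts lam c - parts lam (c + 1)))⁻¹ := by
  have h := parts_eq_zero_of_le hn
  rw [dualCoeff_eq, finprod_eq_prod_range_of_eq_one fun c hc => ?_]
  simp [h c hc, h (c + 1) (by omega)]

theorem dualCoeff_mul_rowU (hq : ‖q‖ < 1) (hs : ‖s‖ < 1) (x : ℂ) (lam mu : YoungDiagram) :
    dualCoeff q s lam * rowU q s x (parts lam) (parts mu) =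
      rowV q s x (parts lam) (parts mu) * dualCoeff q s mu := by
  obtain ⟨n1, hn1⟩ := exists_rowLen_eq_zero lam
  obtain ⟨n2, hn2⟩ := exists_rowLen_eq_zero mu
  replace hn1 := rowLen_eq_zero_of_le hn1 (le_max_left n1 n2)
  replace hn2 := rowLen_eq_zero_of_le hn2 (le_max_right n1 n2)
  have hl := parts_eq_zero_of_le hn1
  have hm := parts_eq_zero_of_le hn2
  rw [dualCoeff_eq_prod hn1, dualCoeff_eq_prod hn2, rowU_eq_prod hl hm, rowV_eq_prod hl hm,
    mul_left_comm, mul_assoc, ← Finset.prod_mul_distrib, ← Finset.prod_mul_distrib]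
  congr 1
  refine Finset.prod_congr rfl fun c _ => ?_
  have h1 := gap_parts_ne_zero hq hs lam c
  have h2 := gap_parts_ne_zero hq hs mu c
  field_simp

theorem hasSum_FDual_succ (hq : ‖q‖ < 1) (hs : ‖s‖ < 1) (lam : YoungDiagram) {n : ℕ}
    {x : Fin (n + 1) → ℂ} (hx : ∀ i, ‖x i‖ < 1) :
    HasSum (fun mu => rowV q s (x (Fin.last n)) (parts lam) (parts mu) *
      FDual q s mu fun i => x i.castSucc) (FDual q s lam x) := by
  have h := (hasSum_F_succ hq hs lam hx).mul_left (dualCoeff q s lam)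
  rw [FDual_eq]
  refine hasSum_of_eq (fun mu => ?_) h
  rw [FDual_eq, ← mul_assoc, ← mul_assoc, dualCoeff_mul_rowU hq hs]

theorem FDual_zero (lam : YoungDiagram) (x : Fin 0 → ℂ) [Decidable (lam = ⊥)] :
    FDual q s lam x = if lam = ⊥ then 1 else 0 := by
  rw [FDual_eq, F_zero]
  split_ifs with h
  · rw [h, dualCoeff_bot, one_mul]
  · rw [mul_zero]
end

/-! ### Bounds -/

section
variable {q s : ℂ}

/-- Comparison with a geometric sequence, since `∏ (1 + r ^ i / R)` converges. -/
theorem prod_add_pow_le {r R : ℝ} (hr0 : 0 ≤ r) (hr : r < 1) (hR : 0 < R) (k : ℕ) :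
    ∏ i ∈ Finset.range k, (R + r ^ i) ≤ Real.exp ((1 - r)⁻¹ / R) * R ^ k := by
  have h1 : ∀ i ∈ Finset.range k, R + r ^ i ≤ R * Real.exp (r ^ i / R) := by
    intro i _
    have := Real.add_one_le_exp (r ^ i / R)
    calc R + r ^ i = R * (r ^ i / R + 1) := by field_simp; ring
      _ ≤ _ := by gcongr
  refine (Finset.prod_le_prod (fun i _ => by positivity) h1).trans ?_
  rw [Finset.prod_mul_distrib, Finset.prod_const, Finset.card_range, ← Real.exp_sum, mul_comm,
    ← Finset.sum_div]
  gcongr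
  exact ((summable_geometric_of_lt_one hr0 hr).sum_le_tsum _ (fun i _ => by positivity)).trans (tsum_geometric_of_lt_one hr0 hr).le

theorem exists_norm_qPoch_inv_le {a : ℂ} (ha : ‖a‖ < 1) (hq : ‖q‖ < 1) :
    ∃ C, ∀ k, ‖(qPoch a q k)⁻¹‖ ≤ C := by
  have h := (tendsto_qPoch a q hq).inv₀ (qPochInf_ne_zero a q ha hq)
  obtain ⟨C, hC⟩ := (Metric.isBounded_range_of_tendsto _ h).exists_norm_le
  exact ⟨C, fun k => hC _ ⟨k, rfl⟩⟩

theorem exists_norm_qPoch_le (hq : ‖q‖ < 1) : ∃ C, ∀ a, ‖a‖ ≤ 1 → ∀ k, ‖qPoch a q k‖ ≤ C := by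
  refine ⟨Real.exp ((1 - ‖q‖)⁻¹ / 1), fun a ha k => ?_⟩
  have h := prod_add_pow_le (norm_nonneg q) hq one_pos k
  rw [one_pow, mul_one] at h
  refine le_trans ?_ h
  rw [qPoch, norm_prod]
  refine Finset.prod_le_prod (fun i _ => norm_nonneg _) fun i _ => (norm_sub_le _ _).trans ?_
  rw [norm_one, norm_mul, norm_pow]
  gcongr
  exact mul_le_of_le_one_left (by positivity) ha

theorem norm_zext_le {f : ℕ → ℂ} {C : ℝ} (h : ∀ k, ‖f k‖ ≤ C) (k : ℤ) :
    ‖zext f k‖ ≤ C := by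
  unfold zext
  split_ifs
  · exact h _
  · rw [norm_zero]; exact (norm_nonneg _).trans (h 0)

theorem exists_norm_stay_le (hq : ‖q‖ < 1) (hs : ‖s‖ < 1) :
    ∃ C, ∀ x, ‖x‖ ≤ 1 → ∀ k, ‖stay q s x k‖ ≤ C := by
  obtain ⟨C1, h1⟩ := exists_norm_qPoch_le hq
  obtain ⟨C2, h2⟩ := exists_norm_qPoch_inv_le hq hq
  refine ⟨C1 * C2, fun x hx => norm_zext_le fun k => ?_⟩
  rw [div_eq_mul_inv, norm_mul]
  have h3 : ‖-s * x‖ ≤ 1 := by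
    rw [norm_mul, norm_neg]; exact mul_le_one₀ hs.le (norm_nonneg _) hx
  have := h1 _ h3 k
  have := (norm_nonneg _).trans this
  gcongr
  exact h2 k

theorem exists_norm_gap_le (hq : ‖q‖ < 1) (hs : ‖s‖ < 1) : ∃ C, ∀ k, ‖gap q s k‖ ≤ C := by
  obtain ⟨C1, h1⟩ := exists_norm_qPoch_le hq
  obtain ⟨C2, h2⟩ := exists_norm_qPoch_inv_le (norm_sq_lt_one hs) hq
  refine ⟨C1 * C2, norm_zext_le fun k => ?_⟩
  rw [div_eq_mul_inv, norm_mul]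
  have := h1 q hq.le k
  have := (norm_nonneg _).trans this
  gcongr
  exact h2 k

theorem exists_norm_gap_inv_le (hq : ‖q‖ < 1) (hs : ‖s‖ < 1) : ∃ C, ∀ k, ‖(gap q s k)⁻¹‖ ≤ C := by
  obtain ⟨C1, h1⟩ := exists_norm_qPoch_le hq
  obtain ⟨C2, h2⟩ := exists_norm_qPoch_inv_le hq hq
  refine ⟨C1 * C2, fun k => ?_⟩
  have h : (gap q s k)⁻¹ = zext (fun k => qPoch (s ^ 2) q k / qPoch q q k) k := by
    unfold gap zext
    split_ifs
    · rw [inv_div]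
    · rw [inv_zero]
  rw [h]
  refine norm_zext_le (fun k => ?_) k
  rw [div_eq_mul_inv, norm_mul]
  have := h1 _ (norm_sq_lt_one hs).le k
  have := (norm_nonneg _).trans this
  gcongr
  exact h2 k

/-- `|jump x (a - b)| ≤ C R^(a - b)`, uniformly for `|x| ≤ R`, in a form that makes sense for
`a < b` too. -/
theorem exists_norm_jump_le (hq : ‖q‖ < 1) (hs : ‖s‖ < 1) {R : ℝ} (hR : 0 < R) :
    ∃ C, 0 ≤ C ∧ ∀ x, ‖x‖ ≤ R → ∀ a b : ℕ, ‖jump q s x (a - b)‖ * R ^ b ≤ C * R ^ a := by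
  obtain ⟨C2, h2⟩ := exists_norm_qPoch_inv_le hq hq
  have hC2 := (norm_nonneg _).trans (h2 0)
  refine ⟨Real.exp ((1 - ‖q‖)⁻¹ / R) * C2, by positivity, fun x hx a b => ?_⟩
  rcases lt_or_ge a b with hab | hab
  · rw [jump_of_neg _ (by omega), norm_zero, zero_mul]; positivity
  obtain ⟨k, rfl⟩ := Nat.exists_eq_add_of_le hab
  have e : ((b + k : ℕ) : ℤ) - b = k := by push_cast; ring
  rw [e, jump, zext_natCast, pow_add, mul_comm (R ^ b), ← mul_assoc, div_eq_mul_inv, norm_mul]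
  have h1 : ‖numer q s x k‖ ≤ Real.exp ((1 - ‖q‖)⁻¹ / R) * R ^ k := by
    refine le_trans ?_ (prod_add_pow_le (norm_nonneg q) hq hR k)
    rw [numer, norm_prod]
    refine Finset.prod_le_prod (fun i _ => norm_nonneg _) fun i _ => (norm_add_le _ _).trans ?_
    rw [norm_mul, norm_pow]
    gcongr
    exact mul_le_of_le_one_left (by positivity) hs.le
  calc ‖numer q s x k‖ * ‖(qPoch q q k)⁻¹‖ * R ^ b
      ≤ (Real.exp ((1 - ‖q‖)⁻¹ / R) * R ^ k) * C2 * R ^ b := by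
        gcongr
        exact h2 k
    _ = _ := by ring

theorem card_eq_sum_rowLen {lam : YoungDiagram} {n : ℕ} (hn : lam.rowLen n = 0) :
    lam.card = ∑ c ∈ Finset.range n, lam.rowLen c := by
  rw [YoungDiagram.card, Finset.card_eq_sum_card_fiberwise (f := Prod.fst) (t := Finset.range n)]
  · exact Finset.sum_congr rfl fun c _ => (YoungDiagram.rowLen_eq_card lam).symm
  · rintro ⟨i, j⟩ hij
    simp only [Finset.coe_range, Set.mem_Iio]
    by_contra hlt
    have h1 := rowLen_eq_zero_of_le hn (not_lt.mp hlt)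
    have h2 : (i, j) ∈ lam := hij
    rw [YoungDiagram.mem_iff_lt_rowLen] at h2
    omega

theorem le_of_parts_le {lam mu : YoungDiagram} (h : ∀ c, parts mu c ≤ parts lam c) : mu ≤ lam := by
  rintro ⟨i, j⟩ hij
  have h1 : (i, j) ∈ mu := hij
  have h2 := h i
  simp only [parts] at h2
  change (i, j) ∈ lam
  rw [YoungDiagram.mem_iff_lt_rowLen] at h1 ⊢
  omega

theorem of_rowU_parts_ne_zero {x : ℂ} {lam mu : YoungDiagram}
    (h : rowU q s x (parts lam) (parts mu) ≠ 0) (c : ℕ) :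
    mu.rowLen c ≤ lam.rowLen c ∧ lam.rowLen (c + 1) ≤ mu.rowLen c := by
  obtain ⟨n1, hn1⟩ := exists_rowLen_eq_zero lam
  obtain ⟨n2, hn2⟩ := exists_rowLen_eq_zero mu
  have := of_rowU_ne_zero (n := max n1 n2) (fun c hc => parts_eq_zero_of_le hn1 c (by omega))
    (fun c hc => parts_eq_zero_of_le hn2 c (by omega)) h c
  simp only [parts] at this
  omega

/-- `|𝔽_{λ/μ}(x)| ≤ C R^(|λ| - |μ|)`, uniformly for `|x| ≤ R` and partitions `λ` with at most `n`
parts. -/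
theorem exists_norm_rowU_le (hq : ‖q‖ < 1) (hs : ‖s‖ < 1) {R : ℝ} (hR : 0 < R) (hR1 : R ≤ 1)
    (n : ℕ) : ∃ C, 0 ≤ C ∧ ∀ x, ‖x‖ ≤ R → ∀ lam mu : YoungDiagram, lam.rowLen n = 0 →
      ‖rowU q s x (parts lam) (parts mu)‖ * R ^ mu.card ≤ C * R ^ lam.card := by
  obtain ⟨C1, hC1, h1⟩ := exists_norm_jump_le hq hs hR
  obtain ⟨C2, h2⟩ := exists_norm_stay_le hq hs
  obtain ⟨C3, h3⟩ := exists_norm_gap_le hq hs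
  have hC2 : 0 ≤ C2 := (norm_nonneg _).trans (h2 0 (by simp) 0)
  have hC3 : 0 ≤ C3 := (norm_nonneg _).trans (h3 0)
  refine ⟨C1 * (C1 * C2 * C3) ^ n, by positivity, fun x hx lam mu hl => ?_⟩
  by_cases h0 : rowU q s x (parts lam) (parts mu) = 0
  · rw [h0, norm_zero, zero_mul]; positivity
  have hm : mu.rowLen n = 0 := by have := (of_rowU_parts_ne_zero h0 n).1; omega
  rw [card_eq_sum_rowLen (rowLen_eq_zero_of_le hl (Nat.le_succ n)),
    card_eq_sum_rowLen (rowLen_eq_zero_of_le hm (Nat.le_succ n)), Finset.sum_range_succ',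
    Finset.sum_range_succ', pow_add, pow_add, ← Finset.prod_pow_eq_pow_sum,
    ← Finset.prod_pow_eq_pow_sum, rowU_eq_prod (parts_eq_zero_of_le hl) (parts_eq_zero_of_le hm),
    norm_mul, norm_prod]
  have hprod : (∏ c ∈ Finset.range n, ‖jump q s x (parts lam (c + 1) - parts mu (c + 1)) *
      stay q s x (parts mu c - parts lam (c + 1)) * gap q s (parts lam c - parts lam (c + 1))‖) *
      ∏ c ∈ Finset.range n, R ^ mu.rowLen (c + 1) ≤
      (C1 * C2 * C3) ^ n * ∏ c ∈ Finset.range n, R ^ lam.rowLen (c + 1) := by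
    rw [← Finset.prod_mul_distrib, ← Finset.card_range n, ← Finset.prod_const, Finset.card_range,
      ← Finset.prod_mul_distrib]
    refine Finset.prod_le_prod (fun c _ => by positivity) fun c _ => ?_
    rw [norm_mul, norm_mul]
    calc _ = (‖jump q s x (parts lam (c + 1) - parts mu (c + 1))‖ * R ^ mu.rowLen (c + 1)) *
          ‖stay q s x (parts mu c - parts lam (c + 1))‖ *
            ‖gap q s (parts lam c - parts lam (c + 1))‖ := by ring
      _ ≤ (C1 * R ^ lam.rowLen (c + 1)) * C2 * C3 := by
        refine mul_le_mul (mul_le_mul (h1 x hx _ _) (h2 x (hx.trans hR1) _) (norm_nonneg _)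
          (by positivity)) (h3 _) (norm_nonneg _) (by positivity)
      _ = _ := by ring
  calc _ = (‖jump q s x (parts lam 0 - parts mu 0)‖ * R ^ mu.rowLen 0) *
      ((∏ c ∈ Finset.range n, ‖jump q s x (parts lam (c + 1) - parts mu (c + 1)) *
        stay q s x (parts mu c - parts lam (c + 1)) *
          gap q s (parts lam c - parts lam (c + 1))‖) *
        ∏ c ∈ Finset.range n, R ^ mu.rowLen (c + 1)) := by ring
    _ ≤ (C1 * R ^ lam.rowLen 0) *
      ((C1 * C2 * C3) ^ n * ∏ c ∈ Finset.range n, R ^ lam.rowLen (c + 1)) :=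
        mul_le_mul (h1 x hx _ _) hprod (by positivity) (by positivity)
    _ = _ := by ring

theorem exists_norm_dualCoeff_le (hq : ‖q‖ < 1) (hs : ‖s‖ < 1) (n : ℕ) :
    ∃ C, 0 ≤ C ∧ ∀ lam : YoungDiagram, lam.rowLen n = 0 → ‖dualCoeff q s lam‖ ≤ C := by
  obtain ⟨C, h⟩ := exists_norm_gap_inv_le hq hs
  have hC := (norm_nonneg _).trans (h 0)
  refine ⟨C ^ n, by positivity, fun lam hl => ?_⟩
  rw [dualCoeff_eq_prod hl, norm_prod, ← Finset.card_range n, ← Finset.prod_const,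
    Finset.card_range]
  exact Finset.prod_le_prod (fun _ _ => norm_nonneg _) fun c _ => h _

theorem norm_halfW_le (hq : ‖q‖ < 1) (hs : ‖s‖ < 1) {x : ℂ} (hx : ‖x‖ < 1) (m e e' : ℤ) :
    ‖halfW q s x m e e'‖ ≤ 2 / ‖1 + s * x‖ := by
  have hp : ∀ k : ℕ, ‖q ^ k‖ ≤ 1 := fun k => by
    rw [norm_pow]; exact pow_le_one₀ (norm_nonneg _) hq.le
  rw [halfW, norm_div]
  gcongr
  split_ifs
  · refine (norm_add_le _ _).trans ?_
    have : ‖s * x * q ^ m.toNat‖ ≤ 1 := by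
      rw [norm_mul, norm_mul]
      exact mul_le_one₀ (mul_le_one₀ hs.le (norm_nonneg _) hx.le) (norm_nonneg _) (hp _)
    rw [norm_one]; linarith
  · rw [norm_mul, norm_neg]
    have h1 : ‖s ^ 2 * q ^ (m - 1).toNat‖ ≤ 1 := by
      rw [norm_mul]
      exact mul_le_one₀ (norm_sq_lt_one hs).le (norm_nonneg _) (hp _)
    have h2 := norm_sub_le 1 (s ^ 2 * q ^ (m - 1).toNat)
    rw [norm_one] at h2
    nlinarith [norm_nonneg x, norm_nonneg (1 - s ^ 2 * q ^ (m - 1).toNat)]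
  · refine (norm_sub_le _ _).trans ?_
    have := hp (m.toNat + 1)
    rw [norm_one]; linarith
  · rw [norm_neg]
    refine (norm_add_le _ _).trans ?_
    have : ‖s * q ^ m.toNat‖ ≤ 1 := by
      rw [norm_mul]; exact mul_le_one₀ hs.le (norm_nonneg _) (hp _)
    linarith
  · simp

theorem exists_norm_rowT_le (hq : ‖q‖ < 1) (hs : ‖s‖ < 1) {x : ℂ} (hx : ‖x‖ < 1) (n : ℕ) :
    ∃ C, 0 ≤ C ∧ ∀ lam mu : YoungDiagram, lam.rowLen n = 0 → mu.rowLen n = 0 →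
      ‖rowT q s x (parts lam) (parts mu)‖ ≤ C := by
  refine ⟨1 * (2 / ‖1 + s * x‖) ^ n, by positivity, fun lam mu hl hm => ?_⟩
  rw [rowT_eq_prod (one_add_mul_ne_zero hs hx) (parts_eq_zero_of_le hl) (parts_eq_zero_of_le hm),
    norm_mul, norm_prod, ← Finset.card_range n, ← Finset.prod_const, Finset.card_range]
  refine mul_le_mul ?_ (Finset.prod_le_prod (fun _ _ => norm_nonneg _)
    fun c _ => norm_halfW_le hq hs hx _ _ _) (by positivity) zero_le_one
  unfold halfLead
  split_ifs
  · simp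
  · rw [norm_neg]; exact hx.le
  · simp

/-! ### Summability -/

/-- The geometric weight `r^|λ|` on partitions with at most `n` parts, zero on other partitions. -/
noncomputable def geomWt (n : ℕ) (r : ℝ) (lam : YoungDiagram) : ℝ :=
  if lam.rowLen n = 0 then r ^ lam.card else 0

theorem geomWt_nonneg (n : ℕ) {r : ℝ} (hr : 0 ≤ r) (lam : YoungDiagram) : 0 ≤ geomWt n r lam := by
  unfold geomWt; split_ifs <;> positivity

theorem geomWt_le_one (n : ℕ) {r : ℝ} (hr : 0 ≤ r) (hr1 : r ≤ 1) (lam : YoungDiagram) :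
    geomWt n r lam ≤ 1 := by
  unfold geomWt
  split_ifs
  · exact pow_le_one₀ hr hr1
  · exact zero_le_one

theorem summable_prod_pow {r : ℝ} (hr : 0 ≤ r) (hr1 : r < 1) (n : ℕ) :
    Summable fun f : Fin n → ℕ => ∏ i, r ^ f i := by
  induction n with
  | zero => exact summable_of_hasFiniteSupport (Set.toFinite _)
  | succ n ih =>
    rw [← (Fin.consEquiv fun _ => ℕ).summable_iff]
    have := (summable_geometric_of_lt_one hr hr1).mul_of_nonneg ih
      (fun _ => by positivity) (fun _ => Finset.prod_nonneg fun _ _ => by positivity)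
    refine this.congr fun p => ?_
    simp [Fin.consEquiv, Fin.prod_univ_succ]

theorem summable_geomWt {r : ℝ} (hr : 0 ≤ r) (hr1 : r < 1) (n : ℕ) : Summable (geomWt n r) := by
  have hsub : Function.support (geomWt n r) ⊆ {lam | lam.rowLen n = 0} := fun lam h => by
    by_contra hne
    exact h (if_neg hne)
  suffices h : Summable (geomWt n r ∘ ((↑) : {lam : YoungDiagram | lam.rowLen n = 0} → _)) by
    obtain ⟨a, ha⟩ := h
    exact ⟨a, (hasSum_subtype_iff_of_support_subset hsub).mp ha⟩
  have hinj : Function.Injective fun (lam : {lam : YoungDiagram | lam.rowLen n = 0}) (i : Fin n) =>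
      lam.1.rowLen i := by
    rintro ⟨lam, hl⟩ ⟨mu, hm⟩ h
    refine Subtype.ext (parts_injective (funext fun c => ?_))
    by_cases hc : c < n
    · have := congrFun h ⟨c, hc⟩
      simpa [parts] using this
    · rw [parts_eq_zero_of_le hl c (by omega), parts_eq_zero_of_le hm c (by omega)]
  refine ((summable_prod_pow hr hr1 n).comp_injective hinj).congr ?_
  rintro ⟨lam, hl⟩
  have hl' : lam.rowLen n = 0 := hl
  simp only [Function.comp, geomWt, hl', if_true]
  rw [Finset.prod_pow_eq_pow_sum, card_eq_sum_rowLen hl', Finset.sum_range]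

/-- Geometric decay of a function on partitions, with support in partitions with at most `n`
parts. -/
def Decays (n : ℕ) (f : YoungDiagram → ℂ) : Prop :=
  ∃ C r : ℝ, 0 ≤ C ∧ 0 < r ∧ r < 1 ∧ ∀ lam, ‖f lam‖ ≤ C * geomWt n r lam

theorem Decays.summable {n : ℕ} {f : YoungDiagram → ℂ} (h : Decays n f) : Summable f := by
  obtain ⟨C, r, -, hr0, hr1, hf⟩ := h
  exact .of_norm_bounded ((summable_geomWt hr0.le hr1 n).mul_left C) hf

theorem Decays.eq_zero {n : ℕ} {f : YoungDiagram → ℂ} (h : Decays n f) {lam : YoungDiagram}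
    (hl : lam.rowLen n ≠ 0) : f lam = 0 := by
  obtain ⟨C, r, -, hr0, hr1, hf⟩ := h
  have := hf lam
  rw [geomWt, if_neg hl, mul_zero] at this
  exact norm_le_zero_iff.mp this

theorem Decays.mul_bounded {n : ℕ} {f g : YoungDiagram → ℂ} (h : Decays n f)
    (hg : ∃ C, 0 ≤ C ∧ ∀ lam, lam.rowLen n = 0 → ‖g lam‖ ≤ C) : Decays n fun lam => g lam * f lam := by
  have h0 := @Decays.eq_zero n f h
  obtain ⟨C, r, hC, hr0, hr1, hf⟩ := h
  obtain ⟨K, hK, hg⟩ := hg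
  refine ⟨K * C, r, by positivity, hr0, hr1, fun lam => ?_⟩
  by_cases hl : lam.rowLen n = 0
  · rw [norm_mul, mul_assoc]
    exact mul_le_mul (hg lam hl) (hf lam) (norm_nonneg _) hK
  · simp only [h0 hl, mul_zero, norm_zero]
    have := geomWt_nonneg n hr0.le lam
    positivity

/-- If `f` decays, then so do the terms of `∑_μ 𝔽_{λ/μ}(x) f(μ)`, jointly in `λ` and `μ`. The decay
in `μ` is gained by a decay rate in `λ` strictly worse than that of `f`. -/
theorem Decays.exists_norm_rowU_mul_le (hq : ‖q‖ < 1) (hs : ‖s‖ < 1) {x : ℂ} (hx : ‖x‖ < 1)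
    {n : ℕ} {f : YoungDiagram → ℂ} (h : Decays n f) :
    ∃ C r t : ℝ, 0 ≤ C ∧ (0 < r ∧ r < 1) ∧ (0 < t ∧ t < 1) ∧ ∀ lam mu,
      ‖rowU q s x (parts lam) (parts mu) * f mu‖ ≤ C * (geomWt (n + 1) r lam * geomWt n t mu) := by
  have hf0 := @Decays.eq_zero n f h
  obtain ⟨C, r, hC, hr0, hr1, hf⟩ := h
  obtain ⟨R, hR, hR1⟩ := exists_between (max_lt hr1 hx)
  obtain ⟨hrR, hxR⟩ := max_lt_iff.mp hR
  have hR0 : 0 < R := hr0.trans hrR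
  obtain ⟨K, hK, hU⟩ := exists_norm_rowU_le hq hs hR0 hR1.le (n + 1)
  refine ⟨K * C, R, r / R, by positivity, ⟨hR0, hR1⟩, ⟨by positivity, (div_lt_one hR0).mpr hrR⟩,
    fun lam mu => ?_⟩
  have hpos : 0 ≤ K * C * (geomWt (n + 1) R lam * geomWt n (r / R) mu) :=
    mul_nonneg (by positivity) (mul_nonneg (geomWt_nonneg _ hR0.le _)
      (geomWt_nonneg _ (by positivity) _))
  by_cases h0 : rowU q s x (parts lam) (parts mu) = 0
  · rwa [h0, zero_mul, norm_zero]
  by_cases hm : mu.rowLen n = 0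
  swap
  · rwa [hf0 hm, mul_zero, norm_zero]
  have hl : lam.rowLen (n + 1) = 0 := by have := (of_rowU_parts_ne_zero h0 n).2; omega
  have hfm := hf mu
  have hUm := hU x hxR.le lam mu hl
  rw [geomWt, if_pos hm] at hfm
  rw [geomWt, if_pos hl, geomWt, if_pos hm, norm_mul, div_pow]
  have hRm : 0 < R ^ mu.card := by positivity
  calc _ ≤ ‖rowU q s x (parts lam) (parts mu)‖ * (C * r ^ mu.card) := by gcongr
    _ = (‖rowU q s x (parts lam) (parts mu)‖ * R ^ mu.card) *
        (C * (r ^ mu.card / R ^ mu.card)) := by field_simp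
    _ ≤ (K * R ^ lam.card) * (C * (r ^ mu.card / R ^ mu.card)) := by gcongr
    _ = _ := by ring

theorem decays_F (hq : ‖q‖ < 1) (hs : ‖s‖ < 1) {n : ℕ} {x : Fin n → ℂ} (hx : ∀ i, ‖x i‖ < 1) :
    Decays n fun lam => F q s lam x := by
  classical
  induction n with
  | zero =>
    refine ⟨1, 1 / 2, zero_le_one, by norm_num, by norm_num, fun lam => ?_⟩
    simp only [F_zero]
    split_ifs with h
    · subst h
      simp [geomWt, rowLen_bot, YoungDiagram.card]
    · rw [norm_zero, one_mul]
      exact geomWt_nonneg _ (by norm_num) _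
  | succ n ih =>
    obtain ⟨C, r, t, hC, ⟨hr0, hr1⟩, ⟨ht0, ht1⟩, h⟩ :=
      (ih fun i => hx i.castSucc).exists_norm_rowU_mul_le hq hs (hx (Fin.last n))
    have hsum := summable_geomWt ht0.le ht1 n
    refine ⟨C * ∑' mu, geomWt n t mu, r,
      mul_nonneg hC (tsum_nonneg (geomWt_nonneg n ht0.le)), hr0, hr1, fun lam => ?_⟩
    simp only [← (hasSum_F_succ hq hs lam hx).tsum_eq]
    refine tsum_of_norm_bounded ?_ (h lam)
    rw [mul_assoc, mul_comm (∑' _, _)]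
    exact (hsum.hasSum.mul_left _).mul_left _

theorem decays_FDual (hq : ‖q‖ < 1) (hs : ‖s‖ < 1) {n : ℕ} {x : Fin n → ℂ}
    (hx : ∀ i, ‖x i‖ < 1) : Decays n fun lam => FDual q s lam x := by
  simp only [FDual_eq]
  exact (decays_F hq hs hx).mul_bounded (exists_norm_dualCoeff_le hq hs n)
end

/-! ### Eigenfunction relation -/

section
variable {q s : ℂ}

/-- Interchange of the order of summation in an absolutely convergent double sum. -/
theorem hasSum_of_hasSum_comm {α β : Type*} {G : α → β → ℂ} {A : α → ℂ} {B : β → ℂ} {t : ℂ}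
    (hG : Summable (Function.uncurry G)) (hA : ∀ a, HasSum (G a) (A a))
    (hB : ∀ b, HasSum (fun a => G a b) (B b)) (ht : HasSum B t) : HasSum A t := by
  have h1 : HasSum A (∑' p, Function.uncurry G p) := hG.hasSum.prod_fiberwise hA
  have h2 : HasSum B (∑' p, Function.uncurry G p) :=
    ((Equiv.prodComm β α).hasSum_iff.mpr hG.hasSum).prod_fiberwise hB
  rwa [ht.unique h2]

theorem summable_uncurry_of_le_geomWt {G : YoungDiagram → YoungDiagram → ℂ} {m n : ℕ} {C r t : ℝ}
    (hr : 0 < r ∧ r < 1) (ht : 0 < t ∧ t < 1)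
    (h : ∀ lam mu, ‖G lam mu‖ ≤ C * (geomWt m r lam * geomWt n t mu)) :
    Summable (Function.uncurry G) := by
  refine .of_norm_bounded (((summable_geomWt hr.1.le hr.2 m).mul_of_nonneg
    (summable_geomWt ht.1.le ht.2 n) (geomWt_nonneg m hr.1.le)
    (geomWt_nonneg n ht.1.le)).mul_left C) ?_
  rintro ⟨lam, mu⟩
  exact h lam mu

theorem finite_setOf_le (lam : YoungDiagram) : {mu : YoungDiagram | mu ≤ lam}.Finite := by
  refine Set.Finite.of_finite_image (f := YoungDiagram.cells) ?_
    (fun a _ b _ h => YoungDiagram.ext h)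
  refine (lam.cells.powerset.finite_toSet).subset ?_
  rintro _ ⟨mu, hmu, rfl⟩
  simpa using hmu

theorem le_of_rowV_ne_zero {x : ℂ} {lam mu : YoungDiagram}
    (h : rowV q s x (parts lam) (parts mu) ≠ 0) : mu ≤ lam := by
  obtain ⟨n1, hn1⟩ := exists_rowLen_eq_zero lam
  obtain ⟨n2, hn2⟩ := exists_rowLen_eq_zero mu
  exact le_of_parts_le fun c => (of_rowV_ne_zero (n := max n1 n2)
    (fun c hc => parts_eq_zero_of_le hn1 c (by omega))
    (fun c hc => parts_eq_zero_of_le hn2 c (by omega)) h c).1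

theorem le_of_rowT_ne_zero (hs : ‖s‖ < 1) {x : ℂ} (hx : ‖x‖ < 1) {lam mu : YoungDiagram}
    (h : rowT q s x (parts lam) (parts mu) ≠ 0) : mu ≤ lam := by
  obtain ⟨n1, hn1⟩ := exists_rowLen_eq_zero lam
  obtain ⟨n2, hn2⟩ := exists_rowLen_eq_zero mu
  exact le_of_parts_le fun c => by
    have := of_rowT_ne_zero (n := max n1 n2) (one_add_mul_ne_zero hs hx)
      (fun c hc => parts_eq_zero_of_le hn1 c (by omega))
      (fun c hc => parts_eq_zero_of_le hn2 c (by omega)) h c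
    omega

/-- The dual spin q-Whittaker polynomials are eigenfunctions of the rows of `halfW` vertices. -/
theorem hasSum_FDual_mul_rowT (hq : ‖q‖ < 1) (hs : ‖s‖ < 1) {x : ℂ} (hx : ‖x‖ < 1) {n : ℕ}
    {y : Fin n → ℂ} (hy : ∀ j, ‖y j‖ < 1) (mu : YoungDiagram) :
    HasSum (fun lam => FDual q s lam y * rowT q s x (parts lam) (parts mu))
      ((∏ j, ((1 - x * y j) / (1 + s * x))) * FDual q s mu y) := by
  classical
  induction n generalizing mu with
  | zero =>
    have h := hasSum_single (f := fun lam => FDual q s lam y * rowT q s x (parts lam) (parts mu)) ⊥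
      fun lam hlam => by rw [FDual_zero, if_neg hlam, zero_mul]
    convert h using 1
    rw [Finset.univ_eq_empty, Finset.prod_empty, one_mul, FDual_zero, FDual_zero, if_pos rfl,
      one_mul]
    split_ifs with hmu
    · subst hmu
      rw [rowT_eq_prod (n := 0) (one_add_mul_ne_zero hs hx) (fun c _ => parts_bot c)
        (fun c _ => parts_bot c)]
      simp
    · symm
      by_contra hne
      exact hmu (le_bot_iff.mp (le_of_rowT_ne_zero hs hx hne))
  | succ n ih =>
    set y' : Fin n → ℂ := fun j => y j.castSucc with hy'
    set z := y (Fin.last n) with hz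
    have ih' := ih (y := y') fun j => hy j.castSucc
    obtain ⟨C, r, t, hC, hr, ht, hb⟩ :=
      (decays_F hq hs (x := y') fun j => hy j.castSucc).exists_norm_rowU_mul_le hq hs
        (hy (Fin.last n))
    obtain ⟨nm, hnm⟩ := exists_rowLen_eq_zero mu
    obtain ⟨K1, hK1, hb1⟩ := exists_norm_rowT_le hq hs hx (max (n + 1) nm)
    obtain ⟨K2, hK2, hb2⟩ := exists_norm_dualCoeff_le hq hs (n + 1)
    have hG : Summable (Function.uncurry fun lam nu => rowV q s z (parts lam) (parts nu) *
        FDual q s nu y' * rowT q s x (parts lam) (parts mu)) := by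
      refine summable_uncurry_of_le_geomWt (C := K1 * K2 * C) (m := n + 1) (n := n) hr ht
        fun lam nu => ?_
      have e : rowV q s z (parts lam) (parts nu) * FDual q s nu y' *
          rowT q s x (parts lam) (parts mu) = rowT q s x (parts lam) (parts mu) *
            dualCoeff q s lam * (rowU q s z (parts lam) (parts nu) * F q s nu y') := by
        rw [FDual_eq]
        linear_combination (-F q s nu y' * rowT q s x (parts lam) (parts mu)) *
          dualCoeff_mul_rowU hq hs z lam nu
      rw [e, norm_mul, norm_mul, mul_assoc (K1 * K2)]
      by_cases hl : lam.rowLen (n + 1) = 0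
      · refine mul_le_mul (mul_le_mul ?_ (hb2 lam hl) (norm_nonneg _) hK1) (hb lam nu)
          (norm_nonneg _) (by positivity)
        exact hb1 lam mu (rowLen_eq_zero_of_le hl (le_max_left _ _))
          (rowLen_eq_zero_of_le hnm (le_max_right _ _))
      · have h0 := hb lam nu
        rw [geomWt, if_neg hl, zero_mul, mul_zero] at h0 ⊢
        rw [le_antisymm h0 (norm_nonneg _), mul_zero, mul_zero]
    set c := (1 - x * z) / (1 + s * x) with hc
    refine hasSum_of_hasSum_comm hG (fun lam => (hasSum_FDual_succ hq hs lam hy).mul_right _)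
      (B := fun nu => FDual q s nu y' * (c * ∑' kap, rowT q s x (parts nu) (parts kap) *
        rowV q s z (parts mu) (parts kap))) (fun nu => ?_) ?_
    · refine hasSum_of_eq (fun lam => ?_)
        ((exchange hq hs hx z mu nu).mul_left (FDual q s nu y'))
      ring
    · -- the inner sum is finite, as `κ ⊆ μ`
      set P := (finite_setOf_le mu).toFinset with hP
      have hsub : ∀ kap ∉ P, rowV q s z (parts mu) (parts kap) = 0 := fun kap hk => by
        by_contra hne
        exact hk (by simpa [hP] using le_of_rowV_ne_zero hne)
      have h1 : HasSum (fun nu => ∑ kap ∈ P, c * rowV q s z (parts mu) (parts kap) *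
          (FDual q s nu y' * rowT q s x (parts nu) (parts kap)))
          (∑ kap ∈ P, c * rowV q s z (parts mu) (parts kap) *
            ((∏ j, ((1 - x * y' j) / (1 + s * x))) * FDual q s kap y')) :=
        hasSum_sum fun kap _ => (ih' kap).mul_left _
      have h2 := (hasSum_FDual_succ hq hs mu hy).unique
        (hasSum_sum_of_ne_finset_zero (s := P) fun kap hk => by rw [hsub kap hk, zero_mul])
      convert hasSum_of_eq (fun nu => ?_) h1 using 1
      · rw [Fin.prod_univ_castSucc, h2, Finset.mul_sum]
        exact Finset.sum_congr rfl fun kap _ => by ring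
      · rw [tsum_eq_sum (s := P) fun kap hk => by rw [hsub kap hk, mul_zero], Finset.mul_sum,
          Finset.mul_sum]
        exact Finset.sum_congr rfl fun kap _ => by ring

/-! ### The sum over one row -/

/-- `∑_λ 𝔽*_λ(y) 𝔽_{λ/μ}(x)`. -/
noncomputable def rowSum (q s : ℂ) {n : ℕ} (y : Fin n → ℂ) (mu : YoungDiagram) (x : ℂ) : ℂ :=
  ∑' lam, FDual q s lam y * rowU q s x (parts lam) (parts mu)

theorem exists_norm_rowU_le_const (hq : ‖q‖ < 1) (hs : ‖s‖ < 1) (n : ℕ) :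
    ∃ C, 0 ≤ C ∧ ∀ x, ‖x‖ ≤ 1 → ∀ lam mu : YoungDiagram, lam.rowLen n = 0 →
      ‖rowU q s x (parts lam) (parts mu)‖ ≤ C := by
  obtain ⟨C, hC, h⟩ := exists_norm_rowU_le hq hs one_pos le_rfl n
  exact ⟨C, hC, fun x hx lam mu hl => by simpa using h x hx lam mu hl⟩

theorem hasSum_rowSum (hq : ‖q‖ < 1) (hs : ‖s‖ < 1) {n : ℕ} {y : Fin n → ℂ} (hy : ∀ j, ‖y j‖ < 1)
    (mu : YoungDiagram) {x : ℂ} (hx : ‖x‖ ≤ 1) :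
    HasSum (fun lam => FDual q s lam y * rowU q s x (parts lam) (parts mu))
      (rowSum q s y mu x) := by
  obtain ⟨C, hC, h⟩ := exists_norm_rowU_le_const hq hs n
  have := (decays_FDual hq hs hy).mul_bounded
    (g := fun lam => rowU q s x (parts lam) (parts mu)) ⟨C, hC, fun lam hl => h x hx lam mu hl⟩
  refine Summable.hasSum (this.summable.congr fun lam => mul_comm _ _)

theorem card_le_card_of_le {lam mu : YoungDiagram} (h : mu ≤ lam) : mu.card ≤ lam.card :=
  Finset.card_le_card h

/-- The `q`-difference equation of `rowSum`, by fusion and the eigenfunction relation. -/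
theorem rowSum_mul (hq : ‖q‖ < 1) (hs : ‖s‖ < 1) {n : ℕ} {y : Fin n → ℂ} (hy : ∀ j, ‖y j‖ < 1)
    (mu : YoungDiagram) {x : ℂ} (hx : ‖x‖ < 1) :
    rowSum q s y mu (q * x) = (∏ j, ((1 - x * y j) / (1 + s * x))) * rowSum q s y mu x := by
  have hqx : ‖q * x‖ ≤ 1 := by rw [norm_mul]; exact mul_le_one₀ hq.le (norm_nonneg _) hx.le
  have hF0 := fun lam hl => (decays_FDual (q := q) (s := s) hq hs hy).eq_zero (lam := lam) hl
  obtain ⟨C, r, hC, hr0, hr1, hF⟩ := decays_FDual (q := q) (s := s) hq hs hy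
  obtain ⟨K1, hK1, hb1⟩ := exists_norm_rowT_le hq hs hx n
  obtain ⟨K2, hK2, hb2⟩ := exists_norm_rowU_le_const hq hs n
  have hr' : 0 < √r ∧ √r < 1 := ⟨Real.sqrt_pos.mpr hr0, by
    rw [Real.sqrt_lt' one_pos]; simpa using hr1⟩
  have hG : Summable (Function.uncurry fun lam nu => FDual q s lam y *
      (rowT q s x (parts lam) (parts nu) * rowU q s x (parts nu) (parts mu))) := by
    refine summable_uncurry_of_le_geomWt (C := C * (K1 * K2)) (m := n) (n := n) hr' hr'
      fun lam nu => ?_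
    have hpos : 0 ≤ C * (K1 * K2) * (geomWt n √r lam * geomWt n √r nu) :=
      mul_nonneg (by positivity) (mul_nonneg (geomWt_nonneg _ hr'.1.le _)
        (geomWt_nonneg _ hr'.1.le _))
    by_cases hT : rowT q s x (parts lam) (parts nu) = 0
    · rwa [hT, zero_mul, mul_zero, norm_zero]
    by_cases hl : lam.rowLen n = 0
    swap
    · rwa [hF0 lam hl, zero_mul, norm_zero]
    have hle := le_of_rowT_ne_zero hs hx hT
    have hn : nu.rowLen n = 0 := by
      by_contra hne
      have h1 : (n, 0) ∈ nu := YoungDiagram.mem_iff_lt_rowLen.mpr (Nat.pos_of_ne_zero hne)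
      have h2 : (n, 0) ∈ lam := hle h1
      rw [YoungDiagram.mem_iff_lt_rowLen] at h2
      omega
    have hFl := hF lam
    rw [geomWt, if_pos hl] at hFl
    rw [geomWt, geomWt, if_pos hl, if_pos hn, norm_mul, norm_mul]
    -- half of the decay in `λ` is passed on to `ν ⊆ λ`
    have hpow : r ^ lam.card ≤ √r ^ lam.card * √r ^ nu.card := by
      calc r ^ lam.card = √r ^ lam.card * √r ^ lam.card := by
            rw [← mul_pow, Real.mul_self_sqrt hr0.le]
        _ ≤ _ := by
            gcongr ?_ * ?_
            exact pow_le_pow_of_le_one hr'.1.le hr'.2.le (card_le_card_of_le hle)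
    calc _ ≤ (C * r ^ lam.card) * (K1 * K2) := by
          refine mul_le_mul hFl (mul_le_mul (hb1 lam nu hl hn) (hb2 x hx.le nu mu hn)
            (norm_nonneg _) hK1) (by positivity) (by positivity)
      _ ≤ (C * (√r ^ lam.card * √r ^ nu.card)) * (K1 * K2) := by gcongr
      _ = _ := by ring
  refine (hasSum_rowSum hq hs hy mu hqx).unique (hasSum_of_hasSum_comm hG
    (fun lam => (hasSum_rowT_mul_rowU hq hs hx lam mu).mul_left _)
    (B := fun nu => (∏ j, ((1 - x * y j) / (1 + s * x))) *
      (FDual q s nu y * rowU q s x (parts nu) (parts mu))) (fun nu => ?_)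
    ((hasSum_rowSum hq hs hy mu hx.le).mul_left _))
  have := (hasSum_FDual_mul_rowT hq hs hx hy nu).mul_right (rowU q s x (parts nu) (parts mu))
  rw [mul_assoc] at this
  exact hasSum_of_eq (fun lam => (mul_assoc _ _ _).symm) this

theorem continuous_zext {f : ℂ → ℕ → ℂ} (h : ∀ k, Continuous fun x => f x k) (k : ℤ) :
    Continuous fun x => zext (f x) k := by
  unfold zext
  split_ifs
  · exact h _
  · exact continuous_const

theorem continuous_rowU (lam mu : YoungDiagram) :
    Continuous fun x => rowU q s x (parts lam) (parts mu) := by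
  obtain ⟨n1, hn1⟩ := exists_rowLen_eq_zero lam
  obtain ⟨n2, hn2⟩ := exists_rowLen_eq_zero mu
  have e := fun x => rowU_eq_prod (q := q) (s := s) (x := x) (n := max n1 n2)
    (fun c hc => parts_eq_zero_of_le hn1 c (by omega))
    (fun c hc => parts_eq_zero_of_le hn2 c (by omega))
  simp only [e]
  have h1 : ∀ k, Continuous fun x => jump q s x k := continuous_zext fun k => by
    unfold numer; fun_prop
  have h2 : ∀ k, Continuous fun x => stay q s x k := continuous_zext fun k => by
    unfold qPoch; fun_prop
  fun_prop

theorem tendsto_rowSum (hq : ‖q‖ < 1) (hs : ‖s‖ < 1) {n : ℕ} {y : Fin n → ℂ}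
    (hy : ∀ j, ‖y j‖ < 1) (mu : YoungDiagram) {x : ℂ} (hx : ‖x‖ < 1) :
    Tendsto (fun k : ℕ => rowSum q s y mu (q ^ k * x)) atTop (𝓝 (rowSum q s y mu 0)) := by
  have hlim : Tendsto (fun k : ℕ => q ^ k * x) atTop (𝓝 0) := by
    simpa using (tendsto_pow_atTop_nhds_zero_of_norm_lt_one hq).mul_const x
  have hF0 := fun lam hl => (decays_FDual (q := q) (s := s) hq hs hy).eq_zero (lam := lam) hl
  have hsum := (decays_FDual (q := q) (s := s) hq hs hy).summable.norm
  obtain ⟨K2, hK2, hb2⟩ := exists_norm_rowU_le_const hq hs n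
  refine tendsto_tsum_of_dominated_convergence (hsum.mul_right K2) (fun lam => ?_)
    (Eventually.of_forall fun k lam => ?_)
  · exact (((continuous_rowU lam mu).tendsto 0).comp hlim).const_mul _
  · by_cases hl : lam.rowLen n = 0
    · rw [norm_mul]
      gcongr
      refine hb2 _ ?_ lam mu hl
      rw [norm_mul, norm_pow]
      exact mul_le_one₀ (pow_le_one₀ (norm_nonneg _) hq.le) (norm_nonneg _) hx.le
    · simp [hF0 lam hl]

/-- The iterated `q`-difference equation, in the limit `q^k x → 0`. -/
theorem prod_qPochInf_mul_rowSum (hq : ‖q‖ < 1) (hs : ‖s‖ < 1) {n : ℕ} {y : Fin n → ℂ}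
    (hy : ∀ j, ‖y j‖ < 1) (mu : YoungDiagram) {x : ℂ} (hx : ‖x‖ < 1) :
    (∏ j, (qPochInf (x * y j) q / qPochInf (-s * x) q)) * rowSum q s y mu x =
      rowSum q s y mu 0 := by
  have h1 : ∀ k : ℕ, rowSum q s y mu (q ^ k * x) =
      (∏ j, (qPoch (x * y j) q k / qPoch (-s * x) q k)) * rowSum q s y mu x := by
    intro k
    induction k with
    | zero => simp [qPoch]
    | succ k ih =>
      have hk : ‖q ^ k * x‖ < 1 := by
        rw [norm_mul, norm_pow]
        have := pow_le_one₀ (norm_nonneg q) hq.le (n := k)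
        nlinarith [norm_nonneg x]
      rw [pow_succ', mul_assoc, rowSum_mul hq hs hy mu hk, ih, ← mul_assoc,
        ← Finset.prod_mul_distrib]
      congr 1
      refine Finset.prod_congr rfl fun j _ => ?_
      rw [qPoch_succ, qPoch_succ, div_mul_div_comm]
      congr 1 <;> ring
  refine tendsto_nhds_unique ?_ (tendsto_rowSum hq hs hy mu hx)
  simp only [h1]
  refine Tendsto.mul_const _ (tendsto_finsetProd _ fun j _ => ?_)
  exact (tendsto_qPoch _ _ hq).div (tendsto_qPoch _ _ hq)
    (qPochInf_ne_zero _ _ (norm_neg_mul_lt_one hs hx) hq)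

/-- At `x = -s` the row acts as the identity, since `numer q s (-s) l = 0` for `l > 0`. -/
theorem rowU_neg_self (hq : ‖q‖ < 1) (hs : ‖s‖ < 1) (lam mu : YoungDiagram) [Decidable (lam = mu)] :
    rowU q s (-s) (parts lam) (parts mu) = if lam = mu then 1 else 0 := by
  obtain ⟨n1, hn1⟩ := exists_rowLen_eq_zero lam
  obtain ⟨n2, hn2⟩ := exists_rowLen_eq_zero mu
  have hl : ∀ c, max n1 n2 ≤ c → parts lam c = 0 := fun c hc =>
    parts_eq_zero_of_le hn1 c (by omega)
  have hm : ∀ c, max n1 n2 ≤ c → parts mu c = 0 := fun c hc =>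
    parts_eq_zero_of_le hn2 c (by omega)
  have hj : ∀ k, jump q s (-s) k ≠ 0 → k = 0 := by
    intro k hk
    have h0 := nonneg_of_zext_ne_zero hk
    lift k to ℕ using h0
    rcases k with _ | k
    · rfl
    · exfalso
      apply hk
      rw [jump, zext_natCast, numer, Finset.prod_range_succ']
      simp
  rw [rowU_eq_prod hl hm]
  split_ifs with h
  · subst h
    rw [sub_self, jump_zero, one_mul]
    refine Finset.prod_eq_one fun c _ => ?_
    rw [sub_self, jump_zero, one_mul, ← state_eq, stay, gap, zext_natCast, zext_natCast]
    have h1 := qPoch_ne_zero q q hq hq (state lam c)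
    have h2 := qPoch_ne_zero (s ^ 2) q (norm_sq_lt_one hs) hq (state lam c)
    rw [show -s * -s = s ^ 2 by ring]
    field_simp
  · by_contra hne
    apply h
    rw [← ne_eq, mul_ne_zero_iff, Finset.prod_ne_zero_iff] at hne
    refine parts_injective (funext fun c => ?_)
    rcases c with _ | c
    · have := hj _ hne.1; omega
    · by_cases hc : c < max n1 n2
      · have := hj _ (left_ne_zero_of_mul (left_ne_zero_of_mul
          (hne.2 c (Finset.mem_range.mpr hc))))
        omega
      · rw [hl _ (by omega), hm _ (by omega)]

theorem rowSum_neg_self (hq : ‖q‖ < 1) (hs : ‖s‖ < 1) {n : ℕ} (y : Fin n → ℂ) (mu : YoungDiagram) :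
    rowSum q s y mu (-s) = FDual q s mu y := by
  classical
  unfold rowSum
  rw [tsum_eq_single mu fun lam h => by rw [rowU_neg_self hq hs, if_neg h, mul_zero],
    rowU_neg_self hq hs, if_pos rfl, mul_one]

/-- The Cauchy identity with one variable `x`: the value at `x` and the value at `-s` are compared
through the value at `0`. -/
theorem rowSum_eq (hq : ‖q‖ < 1) (hs : ‖s‖ < 1) {n : ℕ} {y : Fin n → ℂ} (hy : ∀ j, ‖y j‖ < 1)
    (mu : YoungDiagram) {x : ℂ} (hx : ‖x‖ < 1) :
    rowSum q s y mu x = (∏ j, (qPochInf (-s * x) q * qPochInf (-s * y j) q /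
      (qPochInf (s ^ 2) q * qPochInf (x * y j) q))) * FDual q s mu y := by
  have h1 := prod_qPochInf_mul_rowSum hq hs hy mu hx
  have h2 := prod_qPochInf_mul_rowSum hq hs hy mu (x := -s) (by rwa [norm_neg])
  rw [rowSum_neg_self hq hs, ← h1, show -s * -s = s ^ 2 by ring] at h2
  have hxy : ∀ j, ‖x * y j‖ < 1 := fun j => by
    rw [norm_mul]; nlinarith [norm_nonneg x, norm_nonneg (y j), hy j]
  have e : (∏ j, (qPochInf (-s * x) q * qPochInf (-s * y j) q /
      (qPochInf (s ^ 2) q * qPochInf (x * y j) q))) =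
      (∏ j, (qPochInf (x * y j) q / qPochInf (-s * x) q))⁻¹ *
        ∏ j, (qPochInf (-s * y j) q / qPochInf (s ^ 2) q) := by
    rw [← Finset.prod_inv_distrib, ← Finset.prod_mul_distrib]
    refine Finset.prod_congr rfl fun j _ => ?_
    rw [inv_div, div_mul_div_comm, mul_comm (qPochInf (s ^ 2) q)]
  rw [e, mul_assoc, h2, inv_mul_cancel_left₀]
  exact Finset.prod_ne_zero_iff.mpr fun j _ => div_ne_zero (qPochInf_ne_zero _ _ (hxy j) hq)
    (qPochInf_ne_zero _ _ (norm_neg_mul_lt_one hs hx) hq)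

theorem FDual_bot (hq : ‖q‖ < 1) (hs : ‖s‖ < 1) {n : ℕ} {y : Fin n → ℂ} (hy : ∀ j, ‖y j‖ < 1) :
    FDual q s ⊥ y = 1 := by
  classical
  induction n with
  | zero => rw [FDual_zero, if_pos rfl]
  | succ n ih =>
    have h := hasSum_single (f := fun mu => rowV q s (y (Fin.last n)) (parts ⊥) (parts mu) *
      FDual q s mu fun i => y i.castSucc) ⊥ fun mu hmu => by
        by_contra hne
        exact hmu (le_bot_iff.mp (le_of_rowV_ne_zero (left_ne_zero_of_mul hne)))
    rw [(hasSum_FDual_succ hq hs ⊥ hy).unique h, ih fun j => hy j.castSucc,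
      rowV_eq_prod (n := 0) (fun c _ => parts_bot c) (fun c _ => parts_bot c)]
    simp

theorem hasSum_F_mul_FDual (hq : ‖q‖ < 1) (hs : ‖s‖ < 1) {m n : ℕ} {x : Fin m → ℂ}
    (hx : ∀ i, ‖x i‖ < 1) {y : Fin n → ℂ} (hy : ∀ j, ‖y j‖ < 1) :
    HasSum (fun lam => F q s lam x * FDual q s lam y)
      (∏ i, ∏ j, (qPochInf (-s * x i) q * qPochInf (-s * y j) q /
        (qPochInf (s ^ 2) q * qPochInf (x i * y j) q))) := by
  classical
  induction m with
  | zero =>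
    have h := hasSum_single (f := fun lam => F q s lam x * FDual q s lam y) ⊥
      fun lam hlam => by rw [F_zero, if_neg hlam, zero_mul]
    rw [F_zero, if_pos rfl, one_mul, FDual_bot hq hs hy] at h
    simpa using h
  | succ m ih =>
    set x' : Fin m → ℂ := fun i => x i.castSucc with hx'
    obtain ⟨C, r, t, hC, hr, ht, hb⟩ :=
      (decays_F hq hs (x := x') fun i => hx i.castSucc).exists_norm_rowU_mul_le hq hs
        (hx (Fin.last m))
    obtain ⟨K, r', hK, hr0', hr1', hb'⟩ := decays_FDual (q := q) (s := s) hq hs hy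
    have hG : Summable (Function.uncurry fun lam mu =>
        rowU q s (x (Fin.last m)) (parts lam) (parts mu) * F q s mu x' * FDual q s lam y) := by
      refine summable_uncurry_of_le_geomWt (C := C * K) (m := m + 1) (n := m) hr ht
        fun lam mu => ?_
      have h1 : ‖FDual q s lam y‖ ≤ K :=
        (hb' lam).trans (mul_le_of_le_one_right hK (geomWt_le_one n hr0'.le hr1'.le lam))
      rw [norm_mul, mul_right_comm]
      exact mul_le_mul (hb lam mu) h1 (norm_nonneg _) ((norm_nonneg _).trans (hb lam mu))
    rw [Fin.prod_univ_castSucc, mul_comm]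
    refine hasSum_of_hasSum_comm hG (fun lam => (hasSum_F_succ hq hs lam hx).mul_right _)
      (fun mu => ?_) ((ih fun i => hx i.castSucc).mul_left _)
    have h := (hasSum_rowSum hq hs hy mu (hx (Fin.last m)).le).mul_left (F q s mu x')
    rw [rowSum_eq hq hs hy mu (hx (Fin.last m)), mul_left_comm] at h
    refine hasSum_of_eq (fun lam => ?_) h
    ring
end

end SpinQWhittaker

theorem mainTheorem2 (m n : ℕ) (hm : 0 < m) (hn : 0 < n) (q s : ℂ) (hq : ‖q‖ < 1) (hs : ‖s‖ < 1)
    (x : Fin m → ℂ) (hx : ∀ i, ‖x i‖ < 1) (y : Fin n → ℂ) (hy : ∀ j, ‖y j‖ < 1) :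
    HasSum
      (fun lam : YoungDiagram => SpinQWhittaker.F q s lam x * SpinQWhittaker.FDual q s lam y)
      (∏ i : Fin m, ∏ j : Fin n,
        (SpinQWhittaker.qPochInf (-s * x i) q * SpinQWhittaker.qPochInf (-s * y j) q /
          (SpinQWhittaker.qPochInf (s ^ 2) q * SpinQWhittaker.qPochInf (x i * y j) q))) := by
  exact SpinQWhittaker.hasSum_F_mul_FDual hq hs hx hy
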